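/- Let $N\ge 1$ and let $L_N^{(-1)}(x)=\sum_{k=0}^N\binom{N-1}{N-k}\frac{(-x)^k}{k!}$, with zeros $z_1>\dots>z_N=0$. Let $r\in\mathbb R^N$ be given by $r_i\ge 0$, $r_i^2=2z_i$. Let $C_N^D=\{x\in\mathbb R^N: x_1\ge\dots\ge x_{N-1}\ge |x_N|\}$, and for $x$ in its interior put $$H(x)_i=\sum_{j\ne i}\Bigl(\frac1{x_i-x_j}+\frac1{x_i+x_j}\Bigr),\qquad A(x)_{ij}=\frac1{(x_i-x_j)^2}-\frac1{(x_i+x_j)^2}\ (i\ne j),\qquad A(x)_{ii}=\sum_{j\ne i}\Bigl(\frac{-1}{(x_i-x_j)^2}-\frac1{(x_i+x_j)^2}\Bigr).$$ Let $c>0$, let $\phi$ be the solution of $\dot\phi(t)=H(\phi(t))$, $t\ge0$, in the interior of $C_N^D$ with $\phi(0)=c\,r$, let $(B_t)_{t\ge0}$ be an $N$-dimensional standard Brownian motion, let $w\in\mathbb R^N$, and let $(W_t)_{t\ge 0}$ be the solution of the linear SDE $$dW_t=dB_t+A(\phi(t))\,W_t\,dt,\qquad W_0=w .$$ Then: 1.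 $(W_t)$ is the freezing limit of the Bessel processes of type $D_N$: let $k_0\ge\frac12$ be such that $\sqrt k\,c\,r+w$ is in the interior of $C_N^D$ for all $k\ge k_0$, and for $k\ge k_0$ let $(X_{t,k})_{t\ge0}$ be a solution in $C_N^D$ of $dX_{t,k}=dB_t+k\,H(X_{t,k})\,dt$ with $X_{0,k}=\sqrt k\,c\,r+w$. Then, for every sequence $k_n\ge k_0$ with $k_n\to\infty$, almost surely $X_{t,k_n}-\sqrt{k_n}\,\phi(t)\to W_t$ locally uniformly in $t\ge 0$. 2. $(W_t)$ is a Gaussian process. 3. With $A:=A(r)$ and the unit matrix $E$, the matrix $E-2A$ is invertible, and for every $t>0$ the covariance matrix $\Sigma_t$ of $W_t$ is $$\Sigma_t=(t+c^2)\,(E-2A)^{-1}\Bigl(E-\exp\bigl(\ln\tfrac{c^2}{t+c^2}\,(E-2A)\bigr)\Bigr).$$ In particular (take $w=0$ in the SDE) the same formula holds for the solution with $W_0=0$. -/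

import Mathlib

open MeasureTheory ProbabilityTheory Filter Topology
open scoped NNReal Matrix

noncomputable section

namespace BesselD

/-- The Laguerre polynomial `L_N^{(α)}(x) = ∑_{k=0}^N binom(N+α, N-k) (-x)^k / k!`, for real `α`,
with the generalized binomial coefficient. -/
def laguerre (N : ℕ) (α : ℝ) : Polynomial ℝ :=
  ∑ k ∈ Finset.range (N + 1),
    Polynomial.C (Ring.choose ((N : ℝ) + α) (N - k) * (-1) ^ k / (k.factorial : ℝ)) *
      Polynomial.X ^ k

/-- `r` is the vector with `(r_1^2, …, r_N^2) = 2 (z_1, …, z_N)` and `r_i ≥ 0`, where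
`z_1 > … > z_N` are the zeros of `L_N^{(-1)}`. -/
def IsLaguerreVector {N : ℕ} (r : Fin N → ℝ) : Prop :=
  ∃ z : Fin N → ℝ, StrictAnti z ∧
    (∀ x : ℝ, (laguerre N (-1)).IsRoot x ↔ ∃ i, z i = x) ∧
    ∀ i, 0 ≤ r i ∧ r i ^ 2 = 2 * z i

/-- The closed Weyl chamber `x_1 ≥ … ≥ x_{N-1} ≥ |x_N|` of type `D_N`, written as
`|x_j| ≤ x_i` for all `i < j` (the same inequalities together with their consequences). -/
def chamber (N : ℕ) : Set (Fin N → ℝ) :=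
  {x | ∀ i j, i < j → |x j| ≤ x i}

/-- The drift `H(x)_i = ∑_{j ≠ i} (1/(x_i - x_j) + 1/(x_i + x_j))`. -/
def drift {N : ℕ} (x : Fin N → ℝ) : Fin N → ℝ := fun i =>
  ∑ j ∈ Finset.univ.erase i, (1 / (x i - x j) + 1 / (x i + x j))

/-- The matrix with off-diagonal entries `1/(x_i - x_j)^2 - 1/(x_i + x_j)^2` and diagonal entries
`∑_{j ≠ i} (-1/(x_i - x_j)^2 - 1/(x_i + x_j)^2)`. -/
def matrixA {N : ℕ} (x : Fin N → ℝ) : Matrix (Fin N) (Fin N) ℝ := fun i j =>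
  if i = j then
    ∑ l ∈ Finset.univ.erase i, (-1 / (x i - x l) ^ 2 - 1 / (x i + x l) ^ 2)
  else 1 / (x i - x j) ^ 2 - 1 / (x i + x j) ^ 2

/-- `φ` solves `dx/dt = H(x)` for `t ≥ 0` in the interior of the chamber, with `φ(0) = x`. -/
structure IsFlow {N : ℕ} (φ : ℝ → Fin N → ℝ) (x : Fin N → ℝ) : Prop where
  init : φ 0 = x
  mem : ∀ t, 0 ≤ t → φ t ∈ interior (chamber N)
  deriv : ∀ t, 0 ≤ t → HasDerivWithinAt φ (drift (φ t)) (Set.Ici 0) t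

variable {Ω : Type*} [MeasurableSpace Ω]

/-- A standard `N`-dimensional Brownian motion: `N` independent real Brownian motions. -/
structure IsBrownianVec {N : ℕ} (B : ℝ≥0 → Ω → Fin N → ℝ) (μ : Measure Ω) : Prop where
  brownian : ∀ i, IsBrownianReal (fun t ω => B t ω i) μ
  indep : iIndepFun (fun (i : Fin N) (ω : Ω) (t : ℝ≥0) => B t ω i) μ

/-- `X` is a Bessel process of type `D_N` with multiplicity `k`, started in `x` and driven by `B`:
a continuous process in the closed chamber which solves `dX = dB + k H(X) dt`, `X_0 = x`.
The noise is additive, so the equation is an integral equation for almost every path. -/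
structure IsBesselD {N : ℕ} (B : ℝ≥0 → Ω → Fin N → ℝ) (μ : Measure Ω) (k : ℝ) (x : Fin N → ℝ)
    (X : ℝ≥0 → Ω → Fin N → ℝ) : Prop where
  aemeasurable : ∀ t, AEMeasurable (X t) μ
  cont : ∀ᵐ ω ∂μ, Continuous (fun t => X t ω)
  mem : ∀ᵐ ω ∂μ, ∀ t, X t ω ∈ chamber N
  integrable : ∀ᵐ ω ∂μ, ∀ t : ℝ≥0,
    IntervalIntegrable (fun s : ℝ => drift (X s.toNNReal ω)) volume 0 t
  eq : ∀ᵐ ω ∂μ, ∀ t : ℝ≥0,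
    X t ω = x + B t ω + k • ∫ s in (0 : ℝ)..t, drift (X s.toNNReal ω)

/-- `W` solves the linear equation `dW = dB + A(φ(t)) W dt`, `W_0 = a`. -/
structure IsLinearSDE {N : ℕ} (B : ℝ≥0 → Ω → Fin N → ℝ) (μ : Measure Ω)
    (φ : ℝ → Fin N → ℝ) (a : Fin N → ℝ) (W : ℝ≥0 → Ω → Fin N → ℝ) : Prop where
  aemeasurable : ∀ t, AEMeasurable (W t) μ
  cont : ∀ᵐ ω ∂μ, Continuous (fun t => W t ω)
  eq : ∀ᵐ ω ∂μ, ∀ t : ℝ≥0,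
    W t ω = a + B t ω + ∫ s in (0 : ℝ)..t, matrixA (φ s) *ᵥ W s.toNNReal ω

/-- `X_{t,k} - √k φ(t) → W_t` as `k → ∞`, locally uniformly in `t`, almost surely, along every
sequence of multiplicities `k ≥ k₀` that tends to infinity (so that the exceptional null sets of
the single processes `X k` do no harm). -/
def IsFreezingLimit {N : ℕ} (μ : Measure Ω) (k₀ : ℝ) (X : ℝ → ℝ≥0 → Ω → Fin N → ℝ)
    (φ : ℝ → Fin N → ℝ) (W : ℝ≥0 → Ω → Fin N → ℝ) : Prop :=
  ∀ κ : ℕ → ℝ, (∀ n, k₀ ≤ κ n) → Tendsto κ atTop atTop →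
    ∀ᵐ ω ∂μ, ∀ T : ℝ≥0,
      TendstoUniformlyOn (fun n t => X (κ n) t ω - √(κ n) • φ t) (fun t => W t ω) atTop
        (Set.Iic T)

end BesselD

end

namespace BesselD

/-! ### Laguerre zeros -/

/-! The drift is the gradient of the concave function `∑_{i<j} (log (x_i - x_j) + log (x_i + x_j))`,
it is homogeneous of degree `-1`, and `A` is its Jacobian. Laguerre's equation at the zeros gives
`H(r) = r/2`, so `√(t + c²) r` solves the deterministic equation; concavity makes solutions unique.
Hence `φ(t) = √(t + c²) r` and `A(φ(t)) = (t + c²)⁻¹ A(r)`: the coefficients at different times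
commute and the linear equation is explicitly solvable (`flow_eq`, `matrixA_flow`).

Freezing is a pathwise statement. With `y = X/√k` and `f = W/√k` the additive noise cancels in `y -
φ - f`, leaving the integral of `H(y) - H(φ) - A(φ) f`. As long as `y` keeps away from the walls,
Taylor and Grönwall bound this error by a constant times `sup ‖f‖²`, that is `O(1/k)`; a continuity
argument shows that `y` does keep away (`exists_norm_sub_linearization_le`). Multiplying by `√k`
leaves `O(1/√k)`.

For the law, variation of constants gives `W_t = F(t,0) w + ∫ F(t,s) dB_s` with `F(t,s) = exp((log
(t + c²) - log (s + c²)) A)`. Since `F` is smooth in `s`, the integral is a pathwise limit of finite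
sums, which are linear in the values of `B`. Almost sure limits of centred Gaussian variables are
Gaussian and their variances converge, so the covariance is `∫ F Fᵀ ds`. By symmetry of `A` this is
the integral of an exponential `G`, and `((s + c²) G)' = (E - 2A) G` evaluates it. `E - 2A` is
invertible because `A` is negative semidefinite. -/

open Polynomial in
lemma eval_derivative_prod_X_sub_C {ι : Type*} (s : Finset ι) (z : ι → ℝ) (x : ℝ)
    (hx : ∀ j ∈ s, x ≠ z j) :
    (derivative (∏ j ∈ s, (X - C (z j)))).eval x =
      (∏ j ∈ s, (X - C (z j))).eval x * ∑ j ∈ s, 1 / (x - z j) := by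
  classical
  induction s using Finset.induction_on with
  | empty => simp
  | insert a s ha ih =>
    have h1 : x - z a ≠ 0 := sub_ne_zero.2 (hx a (Finset.mem_insert_self _ _))
    have h2 := ih fun j hj => hx j (Finset.mem_insert_of_mem hj)
    rw [Finset.prod_insert ha, Finset.sum_insert ha, derivative_mul, eval_add, eval_mul, eval_mul,
      h2]
    simp
    field_simp

open Polynomial in
-- With `N = n + 1` the upper entry `N + α = N - 1` is the natural number `n`, so the generalized
-- binomials become ordinary ones.
lemma laguerre_coeff (n k : ℕ) :
    (laguerre (n + 1) (-1)).coeff k =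
      if k ≤ n + 1 then (n.choose (n + 1 - k) : ℝ) * (-1) ^ k / (k.factorial : ℝ) else 0 := by
  have h : ∀ m : ℕ, Ring.choose (((n + 1 : ℕ) : ℝ) + -1) m = (n.choose m : ℝ) := fun m => by
    rw [← Ring.choose_natCast]; congr 1; push_cast; ring
  simp only [laguerre, finsetSum_coeff, coeff_C_mul, coeff_X_pow, h]
  simp

open Polynomial in
-- Laguerre's equation `x y'' + (α + 1 - x) y' + N y = 0` at `α = -1`, where the constant term in
-- front of `y'` vanishes.
lemma laguerre_ode (n : ℕ) :
    X * derivative (derivative (laguerre (n + 1) (-1))) =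
      X * derivative (laguerre (n + 1) (-1)) - C ((n : ℝ) + 1) * laguerre (n + 1) (-1) := by
  ext k
  rcases k with _ | m
  · simp [laguerre_coeff]
  · simp only [coeff_X_mul, coeff_sub, coeff_C_mul, coeff_derivative, laguerre_coeff]
    rcases lt_trichotomy m n with h | h | h
    · obtain ⟨d, rfl⟩ : ∃ d, n = d + m + 1 := ⟨n - (m + 1), by omega⟩
      have h3 := Nat.choose_succ_right_eq (d + m + 1) d
      rw [if_pos (by omega), if_pos (by omega), show d + m + 1 + 1 - (m + 1 + 1) = d by omega,
        show d + m + 1 + 1 - (m + 1) = d + 1 by omega, Nat.factorial_succ (m + 1)]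
      rw [show d + m + 1 - d = m + 1 by omega] at h3
      have h4 : ((d + m + 1).choose (d + 1) : ℝ) * (d + 1) = (d + m + 1).choose d * (m + 1) := by
        exact_mod_cast h3
      have h5 : ((m + 1).factorial : ℝ) ≠ 0 := by positivity
      push_cast
      field_simp
      rw [pow_succ (-1 : ℝ) (m + 1)]
      linear_combination (-1 : ℝ) ^ (m + 1) * h4
    · subst h
      simp
      ring
    · rw [if_neg (by omega), if_neg (by omega)]
      simp

open Polynomial in
-- The degree is at most `n + 1` and there are `n + 1` distinct zeros, so they are all the roots,
-- each simple.
lemma laguerre_eq_prod {n : ℕ} {z : Fin (n + 1) → ℝ} (hz : Function.Injective z)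
    (hroot : ∀ x, (laguerre (n + 1) (-1)).IsRoot x ↔ ∃ i, z i = x) :
    ∃ a : ℝ, a ≠ 0 ∧ laguerre (n + 1) (-1) = C a * ∏ i, (X - C (z i)) := by
  set p := laguerre (n + 1) (-1) with hp
  have hp0 : p ≠ 0 := by
    intro h
    have := congrArg (fun q => coeff q (n + 1)) h
    rw [hp] at this
    simp only [laguerre_coeff] at this
    simp [Nat.factorial_ne_zero] at this
  have hdeg : p.natDegree ≤ n + 1 := by
    rw [natDegree_le_iff_coeff_eq_zero]
    intro k hk
    rw [hp, laguerre_coeff, if_neg (by omega)]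
  have hle : Finset.univ.val.map z ≤ p.roots := by
    rw [Multiset.le_iff_subset (Finset.univ.nodup.map hz)]
    intro x hx
    obtain ⟨i, -, rfl⟩ := Multiset.mem_map.1 hx
    exact (mem_roots hp0).2 ((hroot _).2 ⟨i, rfl⟩)
  have hcard : (Finset.univ.val.map z).card = n + 1 := by simp
  have hroots : Finset.univ.val.map z = p.roots :=
    Multiset.eq_of_le_of_card_le hle (by rw [hcard]; exact (card_roots' p).trans hdeg)
  have hc : p.roots.card = p.natDegree :=
    le_antisymm (card_roots' p) (by rw [← hroots, hcard]; exact hdeg)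
  refine ⟨p.leadingCoeff, leadingCoeff_ne_zero.2 hp0, ?_⟩
  conv_lhs => rw [← C_leadingCoeff_mul_prod_multiset_X_sub_C hc, ← hroots, Multiset.map_map]
  rfl

open Polynomial in
-- Stieltjes' relations. At a zero `z_i ≠ 0` the differential equation reads `L'' = L'`. Writing `L
-- = a (x - z_i) q` gives `L' = a q` and `L'' = 2 a q'` at `z_i`, and `q'/q` is the sum.
lemma sum_inv_sub_laguerre {n : ℕ} {z : Fin (n + 1) → ℝ} (hz : Function.Injective z)
    (hroot : ∀ x, (laguerre (n + 1) (-1)).IsRoot x ↔ ∃ i, z i = x) (i : Fin (n + 1))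
    (hi : z i ≠ 0) : ∑ j ∈ Finset.univ.erase i, 1 / (z i - z j) = 1 / 2 := by
  obtain ⟨a, ha, hp⟩ := laguerre_eq_prod hz hroot
  have ode := congrArg (eval (z i)) (laguerre_ode n)
  rw [hp, ← Finset.mul_prod_erase _ _ (Finset.mem_univ i)] at ode
  have hne : ∀ j ∈ Finset.univ.erase i, z i ≠ z j := fun j hj h =>
    (Finset.ne_of_mem_erase hj) (hz h).symm
  have h1 := eval_derivative_prod_X_sub_C _ z (z i) hne
  have h0 : (∏ j ∈ Finset.univ.erase i, (X - C (z j))).eval (z i) ≠ 0 := by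
    rw [eval_prod]
    exact Finset.prod_ne_zero_iff.2 fun j hj => by simpa [sub_eq_zero] using hne j hj
  generalize (∏ j ∈ Finset.univ.erase i, (X - C (z j))) = q at *
  simp only [derivative_mul, derivative_C, derivative_X_sub_C, eval_mul, eval_add,
    eval_sub, eval_X, eval_C, zero_mul, zero_add, one_mul, sub_self, mul_zero, add_zero, sub_zero,
    map_add, h1] at ode
  have := mul_left_cancel₀ ha (mul_left_cancel₀ hi (by linarith [ode] :
    z i * (a * (2 * (q.eval (z i) * ∑ j ∈ Finset.univ.erase i, 1 / (z i - z j)))) =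
      z i * (a * q.eval (z i))))
  have h3 := mul_left_cancel₀ h0 (by linarith :
    q.eval (z i) * (2 * ∑ j ∈ Finset.univ.erase i, 1 / (z i - z j)) = q.eval (z i) * 1)
  linarith

lemma IsLaguerreVector.abs_lt {N : ℕ} {r : Fin N → ℝ} (hr : IsLaguerreVector r) {i j : Fin N}
    (hij : i < j) : |r j| < r i := by
  obtain ⟨z, hz, -, h⟩ := hr
  have := hz hij
  exact abs_lt_of_sq_lt_sq (by rw [(h i).2, (h j).2]; linarith) (h i).1

/-- Each pair of fractions combines to `2 r_i / (r_i² - r_j²) = r_i / (z_i - z_j)`, so Stieltjes'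
relations apply; where `z_i = 0` both sides vanish. -/
lemma IsLaguerreVector.drift_eq {N : ℕ} (hN : 1 ≤ N) {r : Fin N → ℝ} (hr : IsLaguerreVector r) :
    drift r = (1 / 2 : ℝ) • r := by
  have hr' := hr
  obtain ⟨n, rfl⟩ : ∃ n, N = n + 1 := ⟨N - 1, by omega⟩
  obtain ⟨z, hz, hroot, h⟩ := hr
  ext i
  have key : ∀ j ∈ Finset.univ.erase i,
      1 / (r i - r j) + 1 / (r i + r j) = r i * (1 / (z i - z j)) := by
    intro j hj
    have hne : r i ≠ r j := fun hh => by
      have := (h i).2; rw [hh, (h j).2] at this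
      exact (Finset.ne_of_mem_erase hj) (hz.injective (by linarith))
    have h1 : r i - r j ≠ 0 := sub_ne_zero.2 hne
    have h2 : r i + r j ≠ 0 := fun hh => hne (by linarith [(h i).1, (h j).1])
    have h3 : z i - z j = (r i - r j) * (r i + r j) / 2 := by
      linarith [(h i).2, (h j).2]
    rw [h3]
    field_simp
    ring
  simp only [drift, Pi.smul_apply, smul_eq_mul]
  rw [Finset.sum_congr rfl key, ← Finset.mul_sum]
  by_cases hi : z i = 0
  · have : r i = 0 := by
      have := (h i).2; rw [hi] at this; simpa using this
    simp [this]
  · rw [sum_inv_sub_laguerre hz.injective hroot i hi]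
    ring

/-! ### The interior of the chamber and the monotonicity of the drift -/

/-- Lowering `x_i` slightly stays in the chamber, which makes the inequality strict. -/
lemma abs_lt_of_mem_interior {N : ℕ} {x : Fin N → ℝ} (hx : x ∈ interior (chamber N)) {i j : Fin N}
    (hij : i < j) : |x j| < x i := by
  have h1 : Tendsto (fun ε : ℝ => Function.update x i (x i - ε)) (𝓝 0) (𝓝 x) := by
    have : Continuous (fun ε : ℝ => Function.update x i (x i - ε)) :=
      continuous_const.update i (by fun_prop)
    simpa using this.tendsto 0
  have h2 : ∀ᶠ ε in 𝓝[>] (0 : ℝ), Function.update x i (x i - ε) ∈ chamber N :=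
    (h1.mono_left nhdsWithin_le_nhds).eventually (mem_interior_iff_mem_nhds.1 hx)
  obtain ⟨ε, h3, h4⟩ := (h2.and self_mem_nhdsWithin).exists
  have h5 := h3 i j hij
  have h6 : (0 : ℝ) < ε := h4
  rw [Function.update_self, Function.update_of_ne hij.ne'] at h5
  linarith

/-- The open chamber, described by its inequalities. -/
def openChamber (N : ℕ) : Set (Fin N → ℝ) := {x | ∀ i j, i < j → |x j| < x i}

lemma sub_mul_inv_sub_inv_nonpos {a b : ℝ} (h : 0 < a * b) : (a - b) * (1 / a - 1 / b) ≤ 0 := by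
  have ha : a ≠ 0 := left_ne_zero_of_mul h.ne'
  have hb : b ≠ 0 := right_ne_zero_of_mul h.ne'
  have : (a - b) * (1 / a - 1 / b) = -((a - b) ^ 2 / (a * b)) := by field_simp; ring
  rw [this]
  have : 0 ≤ (a - b) ^ 2 / (a * b) := by positivity
  linarith

lemma sum_sum_erase_symm {N : ℕ} (f : Fin N → Fin N → ℝ) :
    2 * ∑ i, ∑ j ∈ Finset.univ.erase i, f i j =
      ∑ i, ∑ j ∈ Finset.univ.erase i, (f i j + f j i) := by
  have h : ∑ i, ∑ j ∈ Finset.univ.erase i, f i j = ∑ i, ∑ j ∈ Finset.univ.erase i, f j i :=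
    Finset.sum_comm' (by intro i j; simp [ne_comm])
  simp only [Finset.sum_add_distrib]
  linarith

lemma openChamber_pos {N : ℕ} {x : Fin N → ℝ} (hx : x ∈ openChamber N) {i j : Fin N} (h : i < j) :
    0 < x i - x j ∧ 0 < x i + x j := by
  have := abs_lt.1 (hx i j h)
  constructor <;> linarith [this.1, this.2]

/-- Monotonicity of the gradient of a concave function. After symmetrization each pair contributes
two terms `(a - b)(1/a - 1/b)`, with `a`, `b` the differences or sums of coordinates of `x` and `y`;
these have equal sign in the open chamber. -/
lemma drift_monotone {N : ℕ} {x y : Fin N → ℝ} (hx : x ∈ openChamber N) (hy : y ∈ openChamber N) :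
    ∑ i, (x i - y i) * (drift x i - drift y i) ≤ 0 := by
  have h1 : ∑ i, (x i - y i) * (drift x i - drift y i) =
      ∑ i, ∑ j ∈ Finset.univ.erase i, (x i - y i) *
        ((1 / (x i - x j) + 1 / (x i + x j)) - (1 / (y i - y j) + 1 / (y i + y j))) := by
    refine Finset.sum_congr rfl fun i _ => ?_
    rw [drift, drift, ← Finset.sum_sub_distrib, Finset.mul_sum]
  have h2 := sum_sum_erase_symm fun i j => (x i - y i) *
        ((1 / (x i - x j) + 1 / (x i + x j)) - (1 / (y i - y j) + 1 / (y i + y j)))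
  have h3 : ∑ i, ∑ j ∈ Finset.univ.erase i, ((x i - y i) *
        ((1 / (x i - x j) + 1 / (x i + x j)) - (1 / (y i - y j) + 1 / (y i + y j))) +
        (x j - y j) *
        ((1 / (x j - x i) + 1 / (x j + x i)) - (1 / (y j - y i) + 1 / (y j + y i)))) ≤ 0 := by
    refine Finset.sum_nonpos fun i _ => Finset.sum_nonpos fun j hj => ?_
    have hpos : 0 < (x i - x j) * (y i - y j) ∧ 0 < (x i + x j) * (y i + y j) := by
      rcases lt_or_gt_of_ne (Finset.ne_of_mem_erase hj) with h | h
      · have h1 := openChamber_pos hx h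
        have h2 := openChamber_pos hy h
        exact ⟨mul_pos_of_neg_of_neg (by linarith) (by linarith),
          mul_pos (by linarith) (by linarith)⟩
      · have h1 := openChamber_pos hx h
        have h2 := openChamber_pos hy h
        exact ⟨mul_pos h1.1 h2.1, mul_pos h1.2 h2.2⟩
    have e1 := sub_mul_inv_sub_inv_nonpos hpos.1
    have e2 := sub_mul_inv_sub_inv_nonpos hpos.2
    have f1 : 1 / (x j - x i) = -(1 / (x i - x j)) := by rw [← neg_sub, one_div_neg_eq_neg_one_div]
    have f2 : 1 / (y j - y i) = -(1 / (y i - y j)) := by rw [← neg_sub, one_div_neg_eq_neg_one_div]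
    rw [f1, f2, add_comm (x j), add_comm (y j)]
    linarith
  linarith

/-! ### The explicit flow -/

lemma drift_smul {N : ℕ} (a : ℝ) (x : Fin N → ℝ) : drift (a • x) = a⁻¹ • drift x := by
  ext i
  simp only [drift, Pi.smul_apply, smul_eq_mul, Finset.mul_sum, ← mul_sub, ← mul_add, one_div,
    mul_inv]

lemma matrixA_smul {N : ℕ} (a : ℝ) (x : Fin N → ℝ) :
    matrixA (a • x) = (a ^ 2)⁻¹ • matrixA x := by
  ext i j
  simp only [matrixA, Pi.smul_apply, smul_eq_mul, Matrix.smul_apply, ← mul_sub, ← mul_add, mul_pow]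
  split_ifs with h
  · rw [Finset.mul_sum]
    refine Finset.sum_congr rfl fun l _ => ?_
    simp only [div_eq_mul_inv, mul_inv]
    ring
  · simp only [one_div, mul_inv]
    ring

lemma smul_mem_openChamber {N : ℕ} {x : Fin N → ℝ} (hx : x ∈ openChamber N) {a : ℝ} (ha : 0 < a) :
    a • x ∈ openChamber N := fun i j hij => by
  simp only [Pi.smul_apply, smul_eq_mul, abs_mul, abs_of_pos ha]
  exact mul_lt_mul_of_pos_left (hx i j hij) ha

lemma hasDerivAt_sqrt_smul {N : ℕ} {r : Fin N → ℝ} (hr : drift r = (1 / 2 : ℝ) • r) {c : ℝ}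
    (hc : 0 < c) {t : ℝ} (ht : 0 ≤ t) :
    HasDerivAt (fun s : ℝ => √(s + c ^ 2) • r) (drift (√(t + c ^ 2) • r)) t := by
  have h0 : t + c ^ 2 ≠ 0 := by positivity
  have h1 := (((hasDerivAt_id t).add_const (c ^ 2)).sqrt h0).smul_const r
  refine h1.congr_deriv ?_
  rw [drift_smul, hr, smul_smul]
  congr 1
  simp [mul_comm]

/-- Both sides solve the same equation with the same initial value, and `drift_monotone` makes their
squared distance nonincreasing. -/
lemma flow_eq {N : ℕ} (hN : 1 ≤ N) {r : Fin N → ℝ} (hr : IsLaguerreVector r) {c : ℝ} (hc : 0 < c)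
    {φ : ℝ → Fin N → ℝ} (hφ : IsFlow φ (c • r)) {t : ℝ} (ht : 0 ≤ t) :
    φ t = √(t + c ^ 2) • r := by
  set ψ : ℝ → Fin N → ℝ := fun s => √(s + c ^ 2) • r with hψ
  have hψd : ∀ s, 0 ≤ s → HasDerivWithinAt ψ (drift (ψ s)) (Set.Ici 0) s := fun s hs =>
    (hasDerivAt_sqrt_smul (hr.drift_eq hN) hc hs).hasDerivWithinAt
  have hφO : ∀ s, 0 ≤ s → φ s ∈ openChamber N := fun s hs i j hij =>
    abs_lt_of_mem_interior (hφ.mem s hs) hij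
  have hψO : ∀ s, 0 ≤ s → ψ s ∈ openChamber N := fun s hs =>
    smul_mem_openChamber (fun i j hij => hr.abs_lt hij) (by positivity)
  set D : ℝ → ℝ := fun s => ∑ i, (φ s i - ψ s i) ^ 2 with hD
  have hDd : ∀ s, 0 ≤ s → HasDerivWithinAt D
      (∑ i, 2 * ((φ s i - ψ s i) * (drift (φ s) i - drift (ψ s) i))) (Set.Ici 0) s := by
    intro s hs
    refine HasDerivWithinAt.fun_sum fun i _ => ?_
    have h1 := (hasDerivWithinAt_pi.1 (hφ.deriv s hs)) i
    have h2 := (hasDerivWithinAt_pi.1 (hψd s hs)) i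
    refine ((h1.sub h2).pow 2).congr_deriv ?_
    simp only [Pi.sub_apply]
    push_cast
    ring
  have hanti : AntitoneOn D (Set.Ici 0) := by
    refine antitoneOn_of_hasDerivWithinAt_nonpos (convex_Ici 0)
      (fun s hs => (hDd s hs).continuousWithinAt)
      (fun s hs => (hDd s (interior_subset hs)).mono interior_subset) fun s hs => ?_
    rw [← Finset.mul_sum]
    linarith [drift_monotone (hφO s (interior_subset hs)) (hψO s (interior_subset hs))]
  have hD0 : D 0 = 0 := by
    simp [hD, hψ, hφ.init, Real.sqrt_sq hc.le]
  have h1 : D t ≤ 0 := hD0 ▸ hanti (Set.mem_Ici.2 le_rfl) (Set.mem_Ici.2 ht) ht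
  have h2 : D t = 0 := le_antisymm h1 (Finset.sum_nonneg fun i _ => sq_nonneg _)
  ext i
  have h3 := (Finset.sum_eq_zero_iff_of_nonneg fun i _ => sq_nonneg _).1 h2 i (Finset.mem_univ i)
  have h4 := pow_eq_zero_iff (two_ne_zero) |>.1 h3
  exact sub_eq_zero.1 h4

/-! ### The matrix `E - 2A` -/

lemma matrixA_isSymm {N : ℕ} (x : Fin N → ℝ) : (matrixA x).IsSymm := by
  ext i j
  simp only [Matrix.transpose_apply, matrixA]
  by_cases h : i = j
  · subst h; rfl
  · rw [if_neg h, if_neg (Ne.symm h), add_comm, ← neg_sub (x i) (x j), neg_sq]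

/-- The form equals `-∑_{i<j} ((v_i - v_j)²/(x_i - x_j)² + (v_i + v_j)²/(x_i + x_j)²)`. It needs no
condition on `x`, as division by zero contributes zero. -/
lemma dotProduct_matrixA_mulVec_nonpos {N : ℕ} (x v : Fin N → ℝ) :
    v ⬝ᵥ (matrixA x *ᵥ v) ≤ 0 := by
  have h1 : v ⬝ᵥ (matrixA x *ᵥ v) = ∑ i, ∑ j ∈ Finset.univ.erase i,
      (v i * (v j - v i) / (x i - x j) ^ 2 - v i * (v i + v j) / (x i + x j) ^ 2) := by
    refine Finset.sum_congr rfl fun i _ => ?_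
    rw [Matrix.mulVec, dotProduct, ← Finset.add_sum_erase _ _ (Finset.mem_univ i)]
    simp only [matrixA, if_true]
    rw [Finset.sum_mul, ← Finset.sum_add_distrib, Finset.mul_sum]
    refine Finset.sum_congr rfl fun j hj => ?_
    rw [if_neg (Finset.ne_of_mem_erase hj).symm]
    ring
  have h2 := sum_sum_erase_symm fun i j =>
    (v i * (v j - v i) / (x i - x j) ^ 2 - v i * (v i + v j) / (x i + x j) ^ 2)
  rw [← h1] at h2
  have h3 : ∑ i, ∑ j ∈ Finset.univ.erase i,
      ((v i * (v j - v i) / (x i - x j) ^ 2 - v i * (v i + v j) / (x i + x j) ^ 2) +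
        (v j * (v i - v j) / (x j - x i) ^ 2 - v j * (v j + v i) / (x j + x i) ^ 2)) ≤ 0 := by
    refine Finset.sum_nonpos fun i _ => Finset.sum_nonpos fun j _ => ?_
    have e1 : (x j - x i) ^ 2 = (x i - x j) ^ 2 := by ring
    rw [e1, add_comm (x j)]
    have e2 : (v i * (v j - v i) / (x i - x j) ^ 2 - v i * (v i + v j) / (x i + x j) ^ 2) +
        (v j * (v i - v j) / (x i - x j) ^ 2 - v j * (v j + v i) / (x i + x j) ^ 2) =
        -((v i - v j) ^ 2 / (x i - x j) ^ 2) - (v i + v j) ^ 2 / (x i + x j) ^ 2 := by ring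
    rw [e2]
    have := div_nonneg (sq_nonneg (v i - v j)) (sq_nonneg (x i - x j))
    have := div_nonneg (sq_nonneg (v i + v j)) (sq_nonneg (x i + x j))
    linarith
  linarith

lemma isUnit_one_sub_two_smul_matrixA {N : ℕ} (x : Fin N → ℝ) :
    IsUnit (1 - (2 : ℝ) • matrixA x) := by
  rw [← Matrix.mulVec_injective_iff_isUnit]
  refine (injective_iff_map_eq_zero (Matrix.mulVecLin (1 - (2 : ℝ) • matrixA x))).2 fun v hv => ?_
  rw [Matrix.mulVecLin_apply] at hv
  have h1 : v ⬝ᵥ v - 2 * v ⬝ᵥ (matrixA x *ᵥ v) = 0 := by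
    have := congrArg (v ⬝ᵥ ·) hv
    simpa [Matrix.sub_mulVec, Matrix.smul_mulVec, dotProduct_sub] using this
  have h2 := dotProduct_matrixA_mulVec_nonpos x v
  have h3 : 0 ≤ v ⬝ᵥ v := Finset.sum_nonneg fun i _ => mul_self_nonneg _
  exact dotProduct_self_eq_zero.1 (by linarith)

/-! ### Local estimates for the drift -/

/-- The points whose coordinates have pairwise differences and sums of modulus at least `δ`. -/
def gapSet (N : ℕ) (δ : ℝ) : Set (Fin N → ℝ) :=
  {x | ∀ i j, j ≠ i → δ ≤ |x i - x j| ∧ δ ≤ |x i + x j|}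

lemma mem_gapSet_of_norm_sub_le {N : ℕ} {δ ε : ℝ} {x y : Fin N → ℝ} (hx : x ∈ gapSet N (δ + 2 * ε))
    (h : ‖y - x‖ ≤ ε) : y ∈ gapSet N δ := by
  intro i j hij
  have h1 := (norm_le_pi_norm (y - x) i).trans h
  have h2 := (norm_le_pi_norm (y - x) j).trans h
  rw [Pi.sub_apply, Real.norm_eq_abs] at h1 h2
  obtain ⟨h3, h4⟩ := hx i j hij
  constructor
  · have := abs_add_le (y i - y j) (-(y i - x i) + (y j - x j))
    have h5 := abs_add_le (-(y i - x i)) (y j - x j)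
    rw [abs_neg] at h5
    rw [show y i - y j + (-(y i - x i) + (y j - x j)) = x i - x j by ring] at this
    linarith
  · have := abs_add_le (y i + y j) (-(y i - x i) + -(y j - x j))
    have h5 := abs_add_le (-(y i - x i)) (-(y j - x j))
    rw [abs_neg, abs_neg] at h5
    rw [show y i + y j + (-(y i - x i) + -(y j - x j)) = x i + x j by ring] at this
    linarith

lemma abs_inv_sub_inv_le {δ a b : ℝ} (hδ : 0 < δ) (ha : δ ≤ |a|) (hb : δ ≤ |b|) :
    |1 / a - 1 / b| ≤ |a - b| / δ ^ 2 := by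
  have ha0 : a ≠ 0 := abs_pos.1 (hδ.trans_le ha)
  have hb0 : b ≠ 0 := abs_pos.1 (hδ.trans_le hb)
  rw [show 1 / a - 1 / b = -((a - b) / (a * b)) by field_simp; ring, abs_neg, abs_div, abs_mul]
  gcongr
  rw [sq]
  gcongr

/-- The remainder is exactly `h² / (a² (a + h))`. Only the two end points must avoid zero, which
matters because `gapSet` is not convex. -/
lemma abs_inv_add_sub_inv_add_le {δ a h : ℝ} (hδ : 0 < δ) (ha : δ ≤ |a|) (hb : δ ≤ |a + h|) :
    |1 / (a + h) - 1 / a + h / a ^ 2| ≤ h ^ 2 / δ ^ 3 := by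
  have ha0 : a ≠ 0 := abs_pos.1 (hδ.trans_le ha)
  have hb0 : a + h ≠ 0 := abs_pos.1 (hδ.trans_le hb)
  rw [show 1 / (a + h) - 1 / a + h / a ^ 2 = h ^ 2 / (a ^ 2 * (a + h)) by field_simp; ring,
    abs_div, abs_mul, abs_of_nonneg (sq_nonneg h), abs_pow]
  gcongr
  rw [pow_succ]
  gcongr

lemma norm_drift_sub_le {N : ℕ} {δ : ℝ} (hδ : 0 < δ) {x y : Fin N → ℝ} (hx : x ∈ gapSet N δ)
    (hy : y ∈ gapSet N δ) : ‖drift x - drift y‖ ≤ 4 * N / δ ^ 2 * ‖x - y‖ := by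
  rw [pi_norm_le_iff_of_nonneg (by positivity)]
  intro i
  rw [Pi.sub_apply, drift, drift, ← Finset.sum_sub_distrib]
  refine (norm_sum_le _ _).trans ?_
  have h : ∀ j ∈ Finset.univ.erase i,
      ‖1 / (x i - x j) + 1 / (x i + x j) - (1 / (y i - y j) + 1 / (y i + y j))‖ ≤
        4 / δ ^ 2 * ‖x - y‖ := by
    intro j hj
    obtain ⟨a1, a2⟩ := hx i j (Finset.ne_of_mem_erase hj)
    obtain ⟨b1, b2⟩ := hy i j (Finset.ne_of_mem_erase hj)
    have e1 := abs_inv_sub_inv_le hδ a1 b1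
    have e2 := abs_inv_sub_inv_le hδ a2 b2
    have n1 := norm_le_pi_norm (x - y) i
    have n2 := norm_le_pi_norm (x - y) j
    rw [Pi.sub_apply, Real.norm_eq_abs] at n1 n2
    have m1 : |x i - x j - (y i - y j)| ≤ 2 * ‖x - y‖ := by
      have := abs_sub (x i - y i) (x j - y j)
      rw [show x i - x j - (y i - y j) = (x i - y i) - (x j - y j) by ring]
      linarith
    have m2 : |x i + x j - (y i + y j)| ≤ 2 * ‖x - y‖ := by
      have := abs_add_le (x i - y i) (x j - y j)
      rw [show x i + x j - (y i + y j) = (x i - y i) + (x j - y j) by ring]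
      linarith
    rw [Real.norm_eq_abs, add_sub_add_comm]
    calc _ ≤ _ := abs_add_le _ _
      _ ≤ |x i - x j - (y i - y j)| / δ ^ 2 + |x i + x j - (y i + y j)| / δ ^ 2 := add_le_add e1 e2
      _ ≤ 2 * ‖x - y‖ / δ ^ 2 + 2 * ‖x - y‖ / δ ^ 2 := by gcongr
      _ = _ := by ring
  calc _ ≤ _ := Finset.sum_le_sum h
    _ = ((Finset.univ.erase i).card : ℝ) * (4 / δ ^ 2 * ‖x - y‖) := by simp
    _ ≤ (N : ℝ) * (4 / δ ^ 2 * ‖x - y‖) := by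
      gcongr
      exact (Finset.card_le_univ _).trans_eq (Fintype.card_fin N)
    _ = _ := by ring

lemma matrixA_mulVec_apply {N : ℕ} (x v : Fin N → ℝ) (i : Fin N) :
    (matrixA x *ᵥ v) i = ∑ j ∈ Finset.univ.erase i,
      (-((v i - v j) / (x i - x j) ^ 2) - (v i + v j) / (x i + x j) ^ 2) := by
  rw [Matrix.mulVec, dotProduct, ← Finset.add_sum_erase _ _ (Finset.mem_univ i)]
  simp only [matrixA, if_true]
  rw [Finset.sum_mul, ← Finset.sum_add_distrib]
  refine Finset.sum_congr rfl fun j hj => ?_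
  rw [if_neg (Finset.ne_of_mem_erase hj).symm]
  ring

/-- Second-order Taylor estimate. Each of at most `N` summands has two remainders of size
`(2‖v‖)²/δ³`, whence the factor 8. -/
lemma norm_drift_add_sub_le {N : ℕ} {δ : ℝ} (hδ : 0 < δ) {x v : Fin N → ℝ} (hx : x ∈ gapSet N δ)
    (hv : x + v ∈ gapSet N δ) :
    ‖drift (x + v) - drift x - matrixA x *ᵥ v‖ ≤ 8 * N / δ ^ 3 * ‖v‖ ^ 2 := by
  rw [pi_norm_le_iff_of_nonneg (by positivity)]
  intro i
  rw [Pi.sub_apply, Pi.sub_apply, drift, drift, matrixA_mulVec_apply, ← Finset.sum_sub_distrib,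
    ← Finset.sum_sub_distrib]
  refine (norm_sum_le _ _).trans ?_
  have h : ∀ j ∈ Finset.univ.erase i,
      ‖1 / ((x + v) i - (x + v) j) + 1 / ((x + v) i + (x + v) j) -
        (1 / (x i - x j) + 1 / (x i + x j)) -
        (-((v i - v j) / (x i - x j) ^ 2) - (v i + v j) / (x i + x j) ^ 2)‖ ≤
        8 / δ ^ 3 * ‖v‖ ^ 2 := by
    intro j hj
    obtain ⟨a1, a2⟩ := hx i j (Finset.ne_of_mem_erase hj)
    obtain ⟨b1, b2⟩ := hv i j (Finset.ne_of_mem_erase hj)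
    have c1 : (x + v) i - (x + v) j = (x i - x j) + (v i - v j) := by simp; ring
    have c2 : (x + v) i + (x + v) j = (x i + x j) + (v i + v j) := by simp; ring
    rw [c1] at b1 ⊢
    rw [c2] at b2 ⊢
    have e1 := abs_inv_add_sub_inv_add_le hδ a1 b1
    have e2 := abs_inv_add_sub_inv_add_le hδ a2 b2
    have n1 := norm_le_pi_norm v i
    have n2 := norm_le_pi_norm v j
    rw [Real.norm_eq_abs] at n1 n2
    have m1 : (v i - v j) ^ 2 ≤ (2 * ‖v‖) ^ 2 := by
      refine sq_le_sq' ?_ ?_ <;> linarith [abs_le.1 n1, abs_le.1 n2, (abs_le.1 n1).1,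
        (abs_le.1 n1).2, (abs_le.1 n2).1, (abs_le.1 n2).2]
    have m2 : (v i + v j) ^ 2 ≤ (2 * ‖v‖) ^ 2 := by
      refine sq_le_sq' ?_ ?_ <;> linarith [(abs_le.1 n1).1,
        (abs_le.1 n1).2, (abs_le.1 n2).1, (abs_le.1 n2).2]
    rw [Real.norm_eq_abs]
    calc _ = |(1 / ((x i - x j) + (v i - v j)) - 1 / (x i - x j) + (v i - v j) / (x i - x j) ^ 2) +
        (1 / ((x i + x j) + (v i + v j)) - 1 / (x i + x j) + (v i + v j) / (x i + x j) ^ 2)| := by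
          congr 1; ring
      _ ≤ _ := abs_add_le _ _
      _ ≤ (v i - v j) ^ 2 / δ ^ 3 + (v i + v j) ^ 2 / δ ^ 3 := add_le_add e1 e2
      _ ≤ (2 * ‖v‖) ^ 2 / δ ^ 3 + (2 * ‖v‖) ^ 2 / δ ^ 3 := by gcongr
      _ = _ := by ring
  calc _ ≤ _ := Finset.sum_le_sum h
    _ = ((Finset.univ.erase i).card : ℝ) * (8 / δ ^ 3 * ‖v‖ ^ 2) := by simp
    _ ≤ (N : ℝ) * (8 / δ ^ 3 * ‖v‖ ^ 2) := by
      gcongr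
      exact (Finset.card_le_univ _).trans_eq (Fintype.card_fin N)
    _ = _ := by ring

lemma continuousOn_drift {N : ℕ} {δ : ℝ} (hδ : 0 < δ) : ContinuousOn drift (gapSet N δ) := by
  refine continuousOn_pi.2 fun i => continuousOn_finsetSum _ fun j hj => ?_
  refine (continuousOn_const.div (by fun_prop) fun x hx => ?_).add
    (continuousOn_const.div (by fun_prop) fun x hx => ?_)
  · exact abs_pos.1 (hδ.trans_le (hx i j (Finset.ne_of_mem_erase hj)).1)
  · exact abs_pos.1 (hδ.trans_le (hx i j (Finset.ne_of_mem_erase hj)).2)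

lemma continuousOn_matrixA_mulVec {N : ℕ} {δ : ℝ} (hδ : 0 < δ) :
    ContinuousOn (fun p : (Fin N → ℝ) × (Fin N → ℝ) => matrixA p.1 *ᵥ p.2)
      (gapSet N δ ×ˢ Set.univ) := by
  refine continuousOn_pi.2 fun i => ?_
  simp only [matrixA_mulVec_apply]
  refine continuousOn_finsetSum _ fun j hj => ?_
  refine (ContinuousOn.div (by fun_prop) (by fun_prop) fun x hx => ?_).neg.sub
    (ContinuousOn.div (by fun_prop) (by fun_prop) fun x hx => ?_)
  · exact pow_ne_zero 2 <| abs_pos.1 (hδ.trans_le (hx.1 i j (Finset.ne_of_mem_erase hj)).1)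
  · exact pow_ne_zero 2 <| abs_pos.1 (hδ.trans_le (hx.1 i j (Finset.ne_of_mem_erase hj)).2)

/-! ### Comparison with the linearized equation -/

/-- With a globally continuous integrand the primitive is differentiable at the end points too. -/
lemma exists_continuous_eqOn_Icc {E : Type*} [TopologicalSpace E] {g : ℝ → E} {a b : ℝ}
    (hab : a ≤ b) (hg : ContinuousOn g (Set.Icc a b)) :
    ∃ g' : ℝ → E, Continuous g' ∧ Set.EqOn g g' (Set.Icc a b) :=
  ⟨Set.IccExtend hab ((Set.Icc a b).domRestrict g),
    (continuousOn_iff_continuous_domRestrict.1 hg).Icc_extend',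
    fun _ hx => (Set.IccExtend_of_mem hab ((Set.Icc a b).domRestrict g) hx).symm⟩

lemma intervalIntegral_congr_Icc {E : Type*} [NormedAddCommGroup E] [NormedSpace ℝ E]
    {g g' : ℝ → E} {b t : ℝ} (h : Set.EqOn g g' (Set.Icc 0 b)) (ht : t ∈ Set.Icc 0 b) :
    ∫ s in (0 : ℝ)..t, g s = ∫ s in (0 : ℝ)..t, g' s := by
  refine intervalIntegral.integral_congr fun s hs => h ?_
  rw [Set.uIcc_of_le ht.1] at hs
  exact ⟨hs.1, hs.2.trans ht.2⟩

/-- Grönwall's inequality for an integral equation started at zero. -/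
lemma norm_le_of_integral_eq {E : Type*} [NormedAddCommGroup E] [NormedSpace ℝ E] [CompleteSpace E]
    {e g : ℝ → E} {K ε τ : ℝ} (hτ : 0 ≤ τ) (hg : ContinuousOn g (Set.Icc 0 τ))
    (he : ∀ t ∈ Set.Icc 0 τ, e t = ∫ s in (0 : ℝ)..t, g s)
    (hb : ∀ t ∈ Set.Icc 0 τ, ‖g t‖ ≤ K * ‖e t‖ + ε) :
    ∀ t ∈ Set.Icc 0 τ, ‖e t‖ ≤ gronwallBound 0 K ε t := by
  obtain ⟨g', hg', hgg'⟩ := exists_continuous_eqOn_Icc hτ hg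
  have heq : ∀ t ∈ Set.Icc 0 τ, e t = ∫ s in (0 : ℝ)..t, g' s := fun t ht =>
    (he t ht).trans (intervalIntegral_congr_Icc hgg' ht)
  have hd : ∀ t, HasDerivAt (fun u => ∫ s in (0 : ℝ)..u, g' s) (g' t) t := fun t =>
    hg'.integral_hasStrictDerivAt 0 t |>.hasDerivAt
  intro t ht
  have := norm_le_gronwallBound_of_norm_deriv_right_le (a := 0) (b := τ) (δ := 0) (K := K) (ε := ε)
    (f := fun u => ∫ s in (0 : ℝ)..u, g' s) (f' := g')
    (fun t _ => (hd t).continuousAt.continuousWithinAt) (fun t _ => (hd t).hasDerivWithinAt)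
    (by simp) (fun s hs => by
      have hs' : s ∈ Set.Icc 0 τ := ⟨hs.1, hs.2.le⟩
      rw [← heq s hs', ← hgg' hs']
      exact hb s hs') t ht
  rwa [← heq t ht, sub_zero] at this

lemma mem_gapSet_of_le {N : ℕ} {δ ε : ℝ} (h : ε ≤ δ) {x : Fin N → ℝ} (hx : x ∈ gapSet N δ) :
    x ∈ gapSet N ε :=
  fun i j hij => ⟨h.trans (hx i j hij).1, h.trans (hx i j hij).2⟩

/-- Splits at `x + f`: the Lipschitz bound controls the error `y - x - f`, the Taylor bound the
rest. The added 1 keeps the Grönwall constant positive even for `N = 0`. -/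
lemma norm_drift_linearization_le {N : ℕ} {δ m : ℝ} (hδ : 0 < δ) {x f y : Fin N → ℝ}
    (hx : x ∈ gapSet N δ) (hxf : x + f ∈ gapSet N δ) (hy : y ∈ gapSet N δ) (hf : ‖f‖ ≤ m) :
    ‖drift y - drift x - matrixA x *ᵥ f‖ ≤
      (4 * N / δ ^ 2 + 1) * ‖y - x - f‖ + 8 * N / δ ^ 3 * m ^ 2 := by
  have h1 := norm_drift_sub_le hδ hy hxf
  have h2 := norm_drift_add_sub_le hδ hx hxf
  have h3 : 8 * N / δ ^ 3 * ‖f‖ ^ 2 ≤ 8 * N / δ ^ 3 * m ^ 2 := by gcongr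
  rw [← sub_sub] at h1
  have h5 : drift y - drift x - matrixA x *ᵥ f =
    (drift y - drift (x + f)) + (drift (x + f) - drift x - matrixA x *ᵥ f) := by abel
  rw [h5, add_mul, one_mul]
  exact (norm_add_le _ _).trans (by linarith [norm_nonneg (y - x - f)])

/-- As long as the error stays below `δ / 4`, it is quadratic in the perturbation. -/
lemma norm_sub_linearization_le_of_small {N : ℕ} {τ T δ m : ℝ} (hδ : 0 < δ) (hτ : 0 ≤ τ)
    (hτT : τ ≤ T) {φ f y : ℝ → Fin N → ℝ} (hφ : ContinuousOn φ (Set.Icc 0 τ))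
    (hf : ContinuousOn f (Set.Icc 0 τ)) (hy : ContinuousOn y (Set.Icc 0 τ))
    (hgap : ∀ s ∈ Set.Icc 0 τ, φ s ∈ gapSet N (2 * δ)) (hm : ∀ s ∈ Set.Icc 0 τ, ‖f s‖ ≤ m)
    (hmδ : m ≤ δ / 4)
    (heq : ∀ t ∈ Set.Icc 0 τ, y t - φ t - f t =
      ∫ s in (0 : ℝ)..t, (drift (y s) - drift (φ s) - matrixA (φ s) *ᵥ f s))
    (hsmall : ∀ s ∈ Set.Icc 0 τ, ‖y s - φ s - f s‖ ≤ δ / 4) :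
    ∀ t ∈ Set.Icc 0 τ, ‖y t - φ t - f t‖ ≤
      8 * N / δ ^ 3 / (4 * N / δ ^ 2 + 1) * Real.exp ((4 * N / δ ^ 2 + 1) * T) * m ^ 2 := by
  have hφ1 : ∀ s ∈ Set.Icc 0 τ, φ s ∈ gapSet N δ := fun s hs =>
    mem_gapSet_of_le (by linarith) (hgap s hs)
  -- Perturbation and error are each at most `δ/4`; a displacement of `δ/2` costs at most `δ` of the
  -- gap `2δ`.
  have hnear : ∀ s ∈ Set.Icc 0 τ, ∀ v : Fin N → ℝ, ‖v - φ s‖ ≤ δ / 2 → v ∈ gapSet N δ :=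
    fun s hs v hv => mem_gapSet_of_norm_sub_le (by
      rw [show δ + 2 * (δ / 2) = 2 * δ by ring]; exact hgap s hs) hv
  have hf1 : ∀ s ∈ Set.Icc 0 τ, φ s + f s ∈ gapSet N δ := fun s hs =>
    hnear s hs _ (by rw [add_sub_cancel_left]; linarith [hm s hs])
  have hy1 : ∀ s ∈ Set.Icc 0 τ, y s ∈ gapSet N δ := fun s hs => by
    refine hnear s hs _ ?_
    have h := norm_add_le (y s - φ s - f s) (f s)
    rw [sub_add_cancel] at h
    linarith [hsmall s hs, hm s hs]
  have hcont : ContinuousOn (fun s => drift (y s) - drift (φ s) - matrixA (φ s) *ᵥ f s)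
      (Set.Icc 0 τ) := by
    have h1 : ContinuousOn (fun s => drift (y s)) (Set.Icc 0 τ) :=
      ContinuousOn.comp (g := drift) (continuousOn_drift hδ) hy hy1
    have h2 : ContinuousOn (fun s => drift (φ s)) (Set.Icc 0 τ) :=
      ContinuousOn.comp (g := drift) (continuousOn_drift hδ) hφ hφ1
    have h3 : ContinuousOn (fun s => matrixA (φ s) *ᵥ f s) (Set.Icc 0 τ) :=
      ContinuousOn.comp (g := fun p : (Fin N → ℝ) × (Fin N → ℝ) => matrixA p.1 *ᵥ p.2)
        (f := fun s => (φ s, f s)) (continuousOn_matrixA_mulVec hδ) (hφ.prodMk hf)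
        fun s hs => ⟨hφ1 s hs, Set.mem_univ _⟩
    exact (h1.sub h2).sub h3
  have hb : ∀ s ∈ Set.Icc 0 τ, ‖drift (y s) - drift (φ s) - matrixA (φ s) *ᵥ f s‖ ≤
      (4 * N / δ ^ 2 + 1) * ‖y s - φ s - f s‖ + 8 * N / δ ^ 3 * m ^ 2 := fun s hs =>
    norm_drift_linearization_le hδ (hφ1 s hs) (hf1 s hs) (hy1 s hs) (hm s hs)
  have hK0 : 0 < 4 * N / δ ^ 2 + 1 := by positivity
  have hM0 : 0 ≤ 8 * N / δ ^ 3 := by positivity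
  generalize 4 * N / δ ^ 2 + 1 = K at hK0 hb ⊢
  generalize 8 * N / δ ^ 3 = M at hM0 hb ⊢
  have hg := norm_le_of_integral_eq (e := fun s => y s - φ s - f s)
    (g := fun s => drift (y s) - drift (φ s) - matrixA (φ s) *ᵥ f s) (K := K) (ε := M * m ^ 2)
    hτ hcont heq hb
  intro s hs
  refine (hg s hs).trans ?_
  simp only [gronwallBound_of_K_ne_0 hK0.ne', zero_mul, zero_add]
  have h1 : Real.exp (K * s) ≤ Real.exp (K * T) :=
    Real.exp_le_exp.2 (mul_le_mul_of_nonneg_left (hs.2.trans hτT) hK0.le)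
  calc M * m ^ 2 / K * (Real.exp (K * s) - 1) ≤ M * m ^ 2 / K * Real.exp (K * T) := by
        gcongr; linarith
    _ = _ := by ring

/-- A continuous function that starts below a level stays below it, if it does so strictly
as soon as it does so up to the present. -/
lemma forall_lt_of_bootstrap {u : ℝ → ℝ} {T b : ℝ} (hu : ContinuousOn u (Set.Icc 0 T))
    (h0 : u 0 < b)
    (h : ∀ τ ∈ Set.Icc 0 T, (∀ s ∈ Set.Icc 0 τ, u s ≤ b) → u τ < b) :
    ∀ s ∈ Set.Icc 0 T, u s < b := by
  by_contra! hcon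
  -- The infimum of `S` is the first time at which the level is reached; up to it `u ≤ b`.
  set S : Set ℝ := {s ∈ Set.Icc 0 T | b ≤ u s} with hS
  have hSne : S.Nonempty := hcon
  have hSc : IsClosed S := hu.preimage_isClosed_of_isClosed isClosed_Icc isClosed_Ici
  have hSb : BddBelow S := ⟨0, fun s hs => hs.1.1⟩
  have hmem := hSc.csInf_mem hSne hSb
  set τ := sInf S
  have hbefore : ∀ s ∈ Set.Ico 0 τ, u s ≤ b := fun s hs => by
    by_contra! h
    exact absurd (csInf_le hSb ⟨⟨hs.1, hs.2.le.trans hmem.1.2⟩, h.le⟩) (not_le.2 hs.2)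
  have hτ0 : 0 < τ := lt_of_le_of_ne hmem.1.1 fun h => by
    have := hmem.2; rw [← h] at this; linarith
  have hle : ∀ s ∈ Set.Icc 0 τ, u s ≤ b := by
    have hcl : IsClosed {s ∈ Set.Icc 0 τ | u s ≤ b} :=
      (hu.mono (Set.Icc_subset_Icc_right hmem.1.2)).preimage_isClosed_of_isClosed
        isClosed_Icc isClosed_Iic
    have := hcl.closure_subset_iff.2 (show Set.Ico 0 τ ⊆ {s ∈ Set.Icc 0 τ | u s ≤ b} from
      fun s hs => ⟨⟨hs.1, hs.2.le⟩, hbefore s hs⟩)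
    rw [closure_Ico hτ0.ne] at this
    exact fun s hs => (this hs).2
  exact absurd hmem.2 (not_le.2 (h τ hmem.1 hle))

/-- The condition `C m² < δ/4` improves the a priori bound `δ/4` strictly, so the bootstrap removes
that assumption. `C` does not depend on the paths and thus serves all `k` at once. -/
lemma exists_norm_sub_linearization_le {N : ℕ} (T : ℝ) {δ : ℝ} (hδ : 0 < δ) :
    ∃ C : ℝ, 0 ≤ C ∧ ∀ (φ f y : ℝ → Fin N → ℝ) (m : ℝ), ContinuousOn φ (Set.Icc 0 T) →
      ContinuousOn f (Set.Icc 0 T) → ContinuousOn y (Set.Icc 0 T) →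
      (∀ s ∈ Set.Icc 0 T, φ s ∈ gapSet N (2 * δ)) → (∀ s ∈ Set.Icc 0 T, ‖f s‖ ≤ m) →
      m ≤ δ / 4 → C * m ^ 2 < δ / 4 →
      (∀ t ∈ Set.Icc 0 T, y t - φ t - f t =
        ∫ s in (0 : ℝ)..t, (drift (y s) - drift (φ s) - matrixA (φ s) *ᵥ f s)) →
      ∀ t ∈ Set.Icc 0 T, ‖y t - φ t - f t‖ ≤ C * m ^ 2 := by
  refine ⟨8 * N / δ ^ 3 / (4 * N / δ ^ 2 + 1) * Real.exp ((4 * N / δ ^ 2 + 1) * T),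
    by positivity, ?_⟩
  intro φ f y m hφ hf hy hgap hm hmδ hCm heq
  have key : ∀ τ ∈ Set.Icc 0 T, (∀ s ∈ Set.Icc 0 τ, ‖y s - φ s - f s‖ ≤ δ / 4) →
      ∀ s ∈ Set.Icc 0 τ, ‖y s - φ s - f s‖ ≤ _ := fun τ hτ hsmall => by
    have hsub : Set.Icc 0 τ ⊆ Set.Icc 0 T := Set.Icc_subset_Icc_right hτ.2
    exact norm_sub_linearization_le_of_small hδ hτ.1 hτ.2 (hφ.mono hsub) (hf.mono hsub)
      (hy.mono hsub) (fun s hs => hgap s (hsub hs)) (fun s hs => hm s (hsub hs)) hmδ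
      (fun s hs => heq s (hsub hs)) hsmall
  intro t ht
  have hT : 0 ≤ T := ht.1.trans ht.2
  have hlt := forall_lt_of_bootstrap (u := fun s => ‖y s - φ s - f s‖) (b := δ / 4)
    ((hy.sub hφ).sub hf).norm
    (by
      have h0 := heq 0 ⟨le_rfl, hT⟩
      rw [intervalIntegral.integral_same] at h0
      rw [h0, norm_zero]
      positivity)
    (fun τ hτ hsmall => (key τ hτ hsmall τ ⟨hτ.1, le_rfl⟩).trans_lt hCm)
  exact key T ⟨hT, le_rfl⟩ (fun s hs => (hlt s hs).le) t ht

/-- Characteristic functions converge by dominated convergence. At some `t ≠ 0` the limit is nonzero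
by continuity at 0; inverting `|χ(t)| = exp(-v t²/2)` there shows that the variances converge, which
identifies the limit law. -/
lemma exists_hasLaw_gaussianReal_of_tendsto_ae {Ω : Type*} [MeasurableSpace Ω] {μ : Measure Ω}
    [IsProbabilityMeasure μ] {X : ℕ → Ω → ℝ} {Y : Ω → ℝ} (hX : ∀ n, HasGaussianLaw (X n) μ)
    (h0 : ∀ n, μ[X n] = 0) (hY : AEMeasurable Y μ)
    (h : ∀ᵐ ω ∂μ, Tendsto (fun n => X n ω) atTop (𝓝 (Y ω))) :
    ∃ v : ℝ≥0, HasLaw Y (gaussianReal 0 v) μ ∧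
      Tendsto (fun n => Var[X n; μ]) atTop (𝓝 (v : ℝ)) := by
  have hch : ∀ n t, charFun (μ.map (X n)) t = Complex.exp ((-(Var[X n; μ] * t ^ 2 / 2) : ℝ)) := by
    intro n t
    rw [(hX n).map_eq_gaussianReal, charFun_gaussianReal, h0 n,
      Real.coe_toNNReal _ (variance_nonneg _ _)]
    congr 1
    push_cast
    ring
  have hlim : ∀ t, Tendsto (fun n => charFun (μ.map (X n)) t) atTop (𝓝 (charFun (μ.map Y) t)) := by
    intro t
    have hint : ∀ {Z : Ω → ℝ}, AEMeasurable Z μ →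
        charFun (μ.map Z) t = ∫ ω, Complex.exp (t * Z ω * Complex.I) ∂μ := by
      intro Z hZ
      rw [charFun_apply_real, integral_map hZ]
      exact Continuous.aestronglyMeasurable (by fun_prop)
    rw [hint hY]
    simp_rw [fun n => hint (hX n).aemeasurable]
    refine tendsto_integral_of_dominated_convergence (fun _ => 1) (fun n => ?_)
      (integrable_const 1) (fun n => ae_of_all _ fun ω => ?_) ?_
    · have := (hX n).aemeasurable
      exact AEMeasurable.aestronglyMeasurable (by fun_prop)
    · rw [← Complex.ofReal_mul, Complex.norm_exp_ofReal_mul_I]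
    · filter_upwards [h] with ω hω
      exact ((by fun_prop : Continuous fun x : ℝ =>
        Complex.exp (t * x * Complex.I)).tendsto _).comp hω
  have := Measure.isProbabilityMeasure_map (μ := μ) hY
  obtain ⟨t, ht0, ht⟩ : ∃ t : ℝ, t ≠ 0 ∧ charFun (μ.map Y) t ≠ 0 := by
    have hc : Tendsto (charFun (μ.map Y)) (𝓝[≠] 0) (𝓝 (charFun (μ.map Y) 0)) :=
      (continuous_charFun.tendsto 0).mono_left nhdsWithin_le_nhds
    have h1 : charFun (μ.map Y) 0 ≠ 0 := by simp
    obtain ⟨t, h2, h3⟩ := ((hc.eventually_ne h1).and self_mem_nhdsWithin).exists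
    exact ⟨t, h3, h2⟩
  have hv : ∃ v : ℝ, Tendsto (fun n => Var[X n; μ]) atTop (𝓝 v) := by
    refine ⟨-2 / t ^ 2 * Real.log ‖charFun (μ.map Y) t‖, ?_⟩
    have h1 := ((hlim t).norm.log (norm_ne_zero_iff.2 ht)).const_mul (-2 / t ^ 2)
    refine h1.congr fun n => ?_
    rw [hch, ← Complex.ofReal_exp, Complex.norm_real, Real.norm_of_nonneg (Real.exp_pos _).le,
      Real.log_exp]
    field_simp
  obtain ⟨v, hv⟩ := hv
  have hv0 : 0 ≤ v := ge_of_tendsto' hv fun n => variance_nonneg _ _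
  refine ⟨v.toNNReal, ⟨hY, ?_⟩, by rwa [Real.coe_toNNReal _ hv0]⟩
  refine Measure.ext_of_charFun (funext fun s => ?_)
  refine tendsto_nhds_unique (hlim s) ?_
  rw [charFun_gaussianReal, Real.coe_toNNReal _ hv0]
  simp_rw [hch]
  have h2 : Tendsto (fun n => (-(Var[X n; μ] * s ^ 2 / 2) : ℝ)) atTop (𝓝 (-(v * s ^ 2 / 2))) :=
    ((hv.mul_const _).div_const _).neg
  have h3 := (Complex.continuous_exp.tendsto _).comp
    ((Complex.continuous_ofReal.tendsto _).comp h2)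
  convert h3 using 2
  congr 1
  push_cast
  ring_nf

/-! ### The freezing limit -/

lemma exists_mem_gapSet {N : ℕ} {x : Fin N → ℝ} (hx : x ∈ openChamber N) :
    ∃ δ : ℝ, 0 < δ ∧ x ∈ gapSet N δ := by
  have h : ∀ i j : Fin N, ∀ᶠ δ in 𝓝[>] (0 : ℝ), j ≠ i → δ ≤ |x i - x j| ∧ δ ≤ |x i + x j| := by
    intro i j
    by_cases hij : j = i
    · exact Eventually.of_forall fun _ h => absurd hij h
    have h1 : 0 < |x i - x j| ∧ 0 < |x i + x j| := by
      rcases lt_or_gt_of_ne hij with h | h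
      · have := openChamber_pos hx h
        exact ⟨abs_pos.2 (by linarith), abs_pos.2 (by linarith)⟩
      · have := openChamber_pos hx h
        exact ⟨abs_pos.2 (by linarith), abs_pos.2 (by linarith)⟩
    filter_upwards [nhdsWithin_le_nhds (eventually_le_nhds h1.1),
      nhdsWithin_le_nhds (eventually_le_nhds h1.2)] with δ a b _ using ⟨a, b⟩
  have h2 : ∀ᶠ δ in 𝓝[>] (0 : ℝ), ∀ i j : Fin N,
      j ≠ i → δ ≤ |x i - x j| ∧ δ ≤ |x i + x j| :=
    eventually_all.2 fun i => eventually_all.2 fun j => h i j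
  obtain ⟨δ, h3, h4⟩ := (h2.and self_mem_nhdsWithin).exists
  exact ⟨δ, h4, h3⟩

lemma smul_mem_gapSet {N : ℕ} {δ a b : ℝ} {x : Fin N → ℝ} (hx : x ∈ gapSet N δ) (hδ : 0 ≤ δ)
    (hb : 0 ≤ b) (hab : b ≤ a) : a • x ∈ gapSet N (b * δ) := by
  intro i j hij
  obtain ⟨h1, h2⟩ := hx i j hij
  simp only [Pi.smul_apply, smul_eq_mul, ← mul_sub, ← mul_add, abs_mul,
    abs_of_nonneg (hb.trans hab)]
  exact ⟨mul_le_mul hab h1 hδ (hb.trans hab), mul_le_mul hab h2 hδ (hb.trans hab)⟩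

lemma IsFlow.integral_drift_eq {N : ℕ} {φ : ℝ → Fin N → ℝ} {x : Fin N → ℝ} (hφ : IsFlow φ x)
    {δ : ℝ} (hδ : 0 < δ) (hgap : ∀ s, 0 ≤ s → φ s ∈ gapSet N δ) {t : ℝ} (ht : 0 ≤ t) :
    ContinuousOn (fun s => drift (φ s)) (Set.Icc 0 t) ∧
      ∫ s in (0 : ℝ)..t, drift (φ s) = φ t - x := by
  have hc : ContinuousOn φ (Set.Icc 0 t) := fun s hs =>
    (hφ.deriv s hs.1).continuousWithinAt.mono Set.Icc_subset_Ici_self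
  have hd : ContinuousOn (fun s => drift (φ s)) (Set.Icc 0 t) :=
    ContinuousOn.comp (g := drift) (continuousOn_drift hδ) hc fun s hs => hgap s hs.1
  refine ⟨hd, ?_⟩
  rw [← hφ.init]
  refine intervalIntegral.integral_eq_sub_of_hasDeriv_right_of_le ht hc (fun s hs => ?_)
    (hd.intervalIntegrable_of_Icc ht)
  exact (hφ.deriv s hs.1.le).mono (Set.Ioi_subset_Ici hs.1.le)

/-- The rescaled difference of a Bessel path and its deterministic limit solves the
perturbed linear equation. -/
lemma rescaled_integral_eq {N : ℕ} {φ : ℝ → Fin N → ℝ} {x : Fin N → ℝ} (hφ : IsFlow φ x)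
    {δ : ℝ} (hδ : 0 < δ) (hgap : ∀ s, 0 ≤ s → φ s ∈ gapSet N δ) {w : Fin N → ℝ}
    {b W X : ℝ≥0 → Fin N → ℝ} {k : ℝ} (hk : 0 < k) (hWc : Continuous W)
    (hW : ∀ t : ℝ≥0, W t = w + b t + ∫ s in (0 : ℝ)..t, matrixA (φ s) *ᵥ W s.toNNReal)
    (hXi : ∀ t : ℝ≥0, IntervalIntegrable (fun s : ℝ => drift (X s.toNNReal)) volume 0 t)
    (hX : ∀ t : ℝ≥0, X t = √k • x + w + b t +
      k • ∫ s in (0 : ℝ)..t, drift (X s.toNNReal)) {t : ℝ} (ht : 0 ≤ t) :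
    (√k)⁻¹ • X t.toNNReal - φ t - (√k)⁻¹ • W t.toNNReal =
      ∫ s in (0 : ℝ)..t, (drift ((√k)⁻¹ • X s.toNNReal) - drift (φ s) -
        matrixA (φ s) *ᵥ ((√k)⁻¹ • W s.toNNReal)) := by
  obtain ⟨t, rfl⟩ : ∃ u : ℝ≥0, (u : ℝ) = t := ⟨⟨t, ht⟩, rfl⟩
  have hk0 : √k ≠ 0 := (Real.sqrt_pos.2 hk).ne'
  have hφc : ContinuousOn φ (Set.Icc 0 t) := fun s hs =>
    (hφ.deriv s hs.1).continuousWithinAt.mono Set.Icc_subset_Ici_self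
  obtain ⟨hdc, hdi⟩ := hφ.integral_drift_eq hδ hgap ht
  have hWc' : ContinuousOn (fun s : ℝ => W s.toNNReal) (Set.Icc 0 (t : ℝ)) :=
    (hWc.comp continuous_real_toNNReal).continuousOn
  have hA : ContinuousOn (fun s : ℝ => matrixA (φ s) *ᵥ W s.toNNReal) (Set.Icc 0 (t : ℝ)) :=
    ContinuousOn.comp (g := fun p : (Fin N → ℝ) × (Fin N → ℝ) => matrixA p.1 *ᵥ p.2)
      (f := fun s : ℝ => (φ s, W s.toNNReal)) (continuousOn_matrixA_mulVec hδ) (hφc.prodMk hWc')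
      fun s hs => ⟨hgap s hs.1, Set.mem_univ _⟩
  -- By homogeneity `H(X/√k) = √k H(X)`, which matches the drift `k H(X)` divided by `√k`.
  simp only [drift_smul, Matrix.mulVec_smul, inv_inv]
  have i1 : IntervalIntegrable (fun s : ℝ => √k • drift (X s.toNNReal)) volume 0 t :=
    (hXi t).smul (√k)
  have i2 := hdc.intervalIntegrable_of_Icc (μ := volume) ht
  have i3 : IntervalIntegrable (fun s : ℝ => (√k)⁻¹ • matrixA (φ s) *ᵥ W s.toNNReal) volume 0 t :=
    (hA.intervalIntegrable_of_Icc ht).smul (√k)⁻¹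
  rw [intervalIntegral.integral_sub (i1.sub i2) i3, intervalIntegral.integral_sub i1 i2,
    intervalIntegral.integral_smul, intervalIntegral.integral_smul, hdi, Real.toNNReal_coe]
  conv_lhs => rw [hX t, hW t]
  have hkk : (√k)⁻¹ * k = √k := by
    field_simp
    rw [Real.sq_sqrt hk.le]
  rw [smul_add, smul_add, smul_add, smul_add, smul_add, smul_smul, smul_smul, hkk,
    inv_mul_cancel₀ hk0, one_smul]
  abel

/-- The pathwise freezing limit. -/
lemma tendstoUniformlyOn_freezing {N : ℕ} {φ : ℝ → Fin N → ℝ} {x : Fin N → ℝ} (hφ : IsFlow φ x)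
    {δ : ℝ} (hδ : 0 < δ) (hgap : ∀ s, 0 ≤ s → φ s ∈ gapSet N (2 * δ)) {w : Fin N → ℝ}
    {b W : ℝ≥0 → Fin N → ℝ} {X : ℕ → ℝ≥0 → Fin N → ℝ} {κ : ℕ → ℝ} (hκ : ∀ n, 0 < κ n)
    (hκt : Tendsto κ atTop atTop) (hWc : Continuous W)
    (hW : ∀ t : ℝ≥0, W t = w + b t + ∫ s in (0 : ℝ)..t, matrixA (φ s) *ᵥ W s.toNNReal)
    (hXc : ∀ n, Continuous (X n))
    (hXi : ∀ n, ∀ t : ℝ≥0, IntervalIntegrable (fun s : ℝ => drift (X n s.toNNReal)) volume 0 t)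
    (hX : ∀ n, ∀ t : ℝ≥0, X n t = √(κ n) • x + w + b t +
      κ n • ∫ s in (0 : ℝ)..t, drift (X n s.toNNReal)) (T : ℝ≥0) :
    TendstoUniformlyOn (fun n t => X n t - √(κ n) • φ t) W atTop (Set.Iic T) := by
  obtain ⟨C, hC0, hC⟩ := exists_norm_sub_linearization_le (N := N) T hδ
  have hφc : ContinuousOn φ (Set.Icc 0 T) := fun s hs =>
    (hφ.deriv s hs.1).continuousWithinAt.mono Set.Icc_subset_Ici_self
  have hWr : Continuous fun s : ℝ => W s.toNNReal := hWc.comp continuous_real_toNNReal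
  obtain ⟨M, hM⟩ := isCompact_Icc.exists_bound_of_continuousOn (s := Set.Icc (0 : ℝ) T)
    hWr.continuousOn
  have hinv : Tendsto (fun n => (√(κ n))⁻¹) atTop (𝓝 0) :=
    tendsto_inv_atTop_zero.comp (Real.tendsto_sqrt_atTop.comp hκt)
  -- The perturbation `W/√κ` is bounded by `m = M/√κ`. The three limits yield `m ≤ δ/4`, `C m² <
  -- δ/4`, and smallness of `√κ · C m² = C M²/√κ`.
  have hm : Tendsto (fun n => (√(κ n))⁻¹ * M) atTop (𝓝 0) := by
    simpa using hinv.mul_const M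
  have hm2 : Tendsto (fun n => C * ((√(κ n))⁻¹ * M) ^ 2) atTop (𝓝 0) := by
    simpa using (hm.pow 2).const_mul C
  have hm3 : Tendsto (fun n => (√(κ n))⁻¹ * (C * M ^ 2)) atTop (𝓝 0) := by
    simpa using hinv.mul_const (C * M ^ 2)
  rw [Metric.tendstoUniformlyOn_iff]
  intro ε hε
  filter_upwards [hm.eventually_le_const (by positivity : 0 < δ / 4),
    hm2.eventually_lt_const (by positivity : 0 < δ / 4), hm3.eventually_lt_const hε]
    with n h1 h2 h3 t ht
  have hs : 0 < √(κ n) := Real.sqrt_pos.2 (hκ n)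
  have htT : (t : ℝ) ∈ Set.Icc (0 : ℝ) T := ⟨t.2, NNReal.coe_le_coe.2 ht⟩
  have hXr : Continuous fun s : ℝ => X n s.toNNReal := (hXc n).comp continuous_real_toNNReal
  have hbound := hC φ (fun s => (√(κ n))⁻¹ • W s.toNNReal) (fun s => (√(κ n))⁻¹ • X n s.toNNReal)
    ((√(κ n))⁻¹ * M) hφc (hWr.continuousOn.const_smul (√(κ n))⁻¹)
    (hXr.continuousOn.const_smul (√(κ n))⁻¹)
    (fun s hs => hgap s hs.1)
    (fun s h => by
      rw [norm_smul, Real.norm_of_nonneg (inv_nonneg.2 hs.le)]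
      exact mul_le_mul_of_nonneg_left (hM s h) (inv_nonneg.2 hs.le)) h1 h2
    (fun s hs => rescaled_integral_eq hφ (by positivity : 0 < 2 * δ) hgap (hκ n) hWc hW (hXi n)
      (hX n) hs.1) t htT
  rw [Real.toNNReal_coe] at hbound
  have e : X n t - √(κ n) • φ t - W t =
      √(κ n) • ((√(κ n))⁻¹ • X n t - φ t - (√(κ n))⁻¹ • W t) := by
    rw [smul_sub, smul_sub, smul_smul, smul_smul, mul_inv_cancel₀ hs.ne', one_smul, one_smul]
  rw [dist_comm, dist_eq_norm, e, norm_smul, Real.norm_of_nonneg hs.le]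
  calc _ ≤ √(κ n) * (C * ((√(κ n))⁻¹ * M) ^ 2) := mul_le_mul_of_nonneg_left hbound hs.le
    _ = (√(κ n))⁻¹ * (C * M ^ 2) := by field_simp
    _ < ε := h3

/-- Since `√(s + c²) ≥ c`, the gap of `φ` is never smaller than that of `c r`. -/
lemma exists_gap_of_isFlow {N : ℕ} (hN : 1 ≤ N) {r : Fin N → ℝ} (hr : IsLaguerreVector r) {c : ℝ}
    (hc : 0 < c) {φ : ℝ → Fin N → ℝ} (hφ : IsFlow φ (c • r)) :
    ∃ δ : ℝ, 0 < δ ∧ ∀ s, 0 ≤ s → φ s ∈ gapSet N (2 * δ) := by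
  obtain ⟨δ, hδ, h⟩ := exists_mem_gapSet (x := r) fun i j hij => hr.abs_lt hij
  refine ⟨c * δ / 2, by positivity, fun s hs => ?_⟩
  rw [flow_eq hN hr hc hφ hs, show 2 * (c * δ / 2) = c * δ by ring]
  exact smul_mem_gapSet h hδ.le hc.le (Real.le_sqrt_of_sq_le (by linarith))

lemma isFreezingLimit {Ω : Type*} [MeasurableSpace Ω] {μ : Measure Ω} {N : ℕ} (hN : 1 ≤ N)
    {r : Fin N → ℝ} (hr : IsLaguerreVector r) {c : ℝ} (hc : 0 < c) {φ : ℝ → Fin N → ℝ}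
    (hφ : IsFlow φ (c • r)) {B : ℝ≥0 → Ω → Fin N → ℝ} {w : Fin N → ℝ}
    {W : ℝ≥0 → Ω → Fin N → ℝ} (hW : IsLinearSDE B μ φ w W) {k₀ : ℝ} (hk₀ : 0 < k₀)
    {X : ℝ → ℝ≥0 → Ω → Fin N → ℝ}
    (hX : ∀ k, k₀ ≤ k → IsBesselD B μ k (√k • c • r + w) (X k)) :
    IsFreezingLimit μ k₀ X φ W := by
  intro κ hκ hκt
  obtain ⟨δ, hδ, hgap⟩ := exists_gap_of_isFlow hN hr hc hφ
  filter_upwards [hW.cont, hW.eq, ae_all_iff.2 fun n => (hX _ (hκ n)).cont,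
    ae_all_iff.2 fun n => (hX _ (hκ n)).integrable, ae_all_iff.2 fun n => (hX _ (hκ n)).eq]
    with ω h1 h2 h3 h4 h5 T
  exact tendstoUniformlyOn_freezing hφ hδ hgap (fun n => hk₀.trans_le (hκ n)) hκt h1 h2 h3 h4 h5 T

/-! ### Riemann–Stieltjes sums -/

/-- Riemann sums of `u` against the weight `v`, over `n + 1` intervals of equal length. -/
lemma tendsto_sum_mul_integral {u v : ℝ → ℝ} {t : ℝ} (ht : 0 ≤ t)
    (hu : ContinuousOn u (Set.Icc 0 t)) (hv : ContinuousOn v (Set.Icc 0 t)) {ξ : ℕ → ℕ → ℝ}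
    (hξ : ∀ n k : ℕ, ξ n k ∈ Set.Icc ((k : ℝ) * (t / (n + 1))) (((k + 1 : ℕ) : ℝ) * (t / (n + 1)))) :
    Tendsto (fun n : ℕ => ∑ k ∈ Finset.range (n + 1),
        u (ξ n k) * ∫ s in ((k : ℝ) * (t / (n + 1)))..(((k + 1 : ℕ) : ℝ) * (t / (n + 1))), v s) atTop
      (𝓝 (∫ s in (0 : ℝ)..t, u s * v s)) := by
  obtain ⟨M, hM⟩ := isCompact_Icc.exists_bound_of_continuousOn hv
  have hM0 : 0 ≤ M := (norm_nonneg _).trans (hM 0 ⟨le_rfl, ht⟩)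
  have huc := (isCompact_Icc (a := (0 : ℝ)) (b := t)).uniformContinuousOn_of_continuous hu
  rw [Metric.uniformContinuousOn_iff] at huc
  rw [Metric.tendsto_nhds]
  intro ε hε
  -- The total error is at most the oscillation of `u` times `M t`; the 1 covers `M t = 0`.
  obtain ⟨η, hη, huη⟩ := huc (ε / (M * t + 1)) (by positivity)
  have hlim : Tendsto (fun n : ℕ => t / ((n : ℝ) + 1)) atTop (𝓝 0) :=
    tendsto_const_nhds.div_atTop (tendsto_natCast_atTop_atTop.atTop_add tendsto_const_nhds)
  filter_upwards [hlim.eventually_lt_const hη] with n hn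
  set h : ℝ := t / (n + 1) with hh
  have h0 : 0 ≤ h := by positivity
  have hnh : ((n + 1 : ℕ) : ℝ) * h = t := by rw [hh]; push_cast; field_simp
  have hle : ∀ k : ℕ, (k : ℝ) * h ≤ ((k + 1 : ℕ) : ℝ) * h := fun k => by
    push_cast; nlinarith
  have hsub : ∀ k < n + 1, Set.Icc ((k : ℝ) * h) ((k + 1 : ℕ) * h) ⊆ Set.Icc 0 t := by
    intro k hk
    refine Set.Icc_subset_Icc (by positivity) ?_
    rw [← hnh]
    gcongr
    omega
  have hint : ∀ k < n + 1, IntervalIntegrable (fun s => u s * v s) volume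
      ((k : ℝ) * h) ((k + 1 : ℕ) * h) := fun k hk =>
    ((hu.mul hv).mono (hsub k hk)).intervalIntegrable_of_Icc (hle k)
  have hsum : ∫ s in (0 : ℝ)..t, u s * v s = ∑ k ∈ Finset.range (n + 1),
      ∫ s in ((k : ℝ) * h)..((k + 1 : ℕ) * h), u s * v s := by
    rw [intervalIntegral.sum_integral_adjacent_intervals (a := fun k : ℕ => (k : ℝ) * h) hint, hnh]
    simp
  rw [hsum, dist_eq_norm, ← Finset.sum_sub_distrib]
  have hterm : ∀ k ∈ Finset.range (n + 1),
      ‖(u (ξ n k) * ∫ s in ((k : ℝ) * h)..((k + 1 : ℕ) * h), v s) -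
        ∫ s in ((k : ℝ) * h)..((k + 1 : ℕ) * h), u s * v s‖ ≤
      ε / (M * t + 1) * M * h := by
    intro k hk
    have hk' := Finset.mem_range.1 hk
    have hvi : IntervalIntegrable v volume ((k : ℝ) * h) ((k + 1 : ℕ) * h) :=
      (hv.mono (hsub k hk')).intervalIntegrable_of_Icc (hle k)
    rw [← intervalIntegral.integral_const_mul,
      ← intervalIntegral.integral_sub (hvi.const_mul _) (hint k hk')]
    have hb := intervalIntegral.norm_integral_le_of_norm_le_const
      (a := (k : ℝ) * h) (b := (k + 1 : ℕ) * h) (C := ε / (M * t + 1) * M)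
      (f := fun s => u (ξ n k) * v s - u s * v s) (fun s hs => by
        rw [Set.uIoc_of_le (hle k)] at hs
        have hs' : s ∈ Set.Icc ((k : ℝ) * h) ((k + 1 : ℕ) * h) := ⟨hs.1.le, hs.2⟩
        rw [← sub_mul, norm_mul]
        refine mul_le_mul ?_ (hM s (hsub k hk' hs')) (norm_nonneg _) (by positivity)
        rw [← dist_eq_norm]
        refine (huη _ (hsub k hk' (hξ n k)) s (hsub k hk' hs') ?_).le
        refine (Real.dist_le_of_mem_Icc (hξ n k) hs').trans_lt ?_
        push_cast
        linarith)
    refine hb.trans_eq ?_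
    rw [abs_of_nonneg (by linarith [hle k])]
    push_cast
    ring
  refine (norm_sum_le _ _).trans_lt ((Finset.sum_le_sum hterm).trans_lt ?_)
  simp only [Finset.sum_const, Finset.card_range, nsmul_eq_mul]
  calc ((n + 1 : ℕ) : ℝ) * (ε / (M * t + 1) * M * h) = ε / (M * t + 1) * M * t := by
        rw [mul_comm, mul_assoc, mul_comm h, hnh]
    _ = ε * (M * t / (M * t + 1)) := by ring
    _ < ε * 1 := by
        gcongr
        rw [div_lt_one (by positivity)]
        linarith
    _ = ε := mul_one _

lemma tendsto_riemannSum {u : ℝ → ℝ} {t : ℝ} (ht : 0 ≤ t) (hu : ContinuousOn u (Set.Icc 0 t)) :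
    Tendsto (fun n : ℕ => ∑ k ∈ Finset.range (n + 1), u ((k : ℝ) * (t / (n + 1))) * (t / (n + 1)))
      atTop (𝓝 (∫ s in (0 : ℝ)..t, u s)) := by
  have := tendsto_sum_mul_integral ht hu (v := fun _ => 1) continuousOn_const
    (ξ := fun n k => (k : ℝ) * (t / ((n : ℝ) + 1))) fun n k => ⟨le_rfl, by
      have : 0 ≤ t / ((n : ℝ) + 1) := by positivity
      push_cast; nlinarith⟩
  simp only [mul_one] at this
  refine this.congr fun n => Finset.sum_congr rfl fun k _ => ?_
  rw [intervalIntegral.integral_const, smul_eq_mul, mul_one]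
  push_cast
  ring

/-- Stieltjes sums against a continuous path, by summation by parts. -/
lemma tendsto_stieltjesSum {f f' b : ℝ → ℝ} {t : ℝ} (ht : 0 ≤ t)
    (hf : ∀ s ∈ Set.Icc 0 t, HasDerivAt f (f' s) s) (hf' : ContinuousOn f' (Set.Icc 0 t))
    (hb : ContinuousOn b (Set.Icc 0 t)) :
    Tendsto (fun n : ℕ => ∑ k ∈ Finset.range (n + 1), f ((k : ℝ) * (t / (n + 1))) *
        (b ((k + 1 : ℕ) * (t / (n + 1))) - b ((k : ℝ) * (t / (n + 1)))))
      atTop (𝓝 (f t * b t - f 0 * b 0 - ∫ s in (0 : ℝ)..t, b s * f' s)) := by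
  -- Right end points, because `f_k (b_{k+1} - b_k) = (f_{k+1} b_{k+1} - f_k b_k) - b_{k+1} (f_{k+1}
  -- - f_k)`.
  have h1 := tendsto_sum_mul_integral ht hb hf'
    (ξ := fun n k => ((k + 1 : ℕ) : ℝ) * (t / ((n : ℝ) + 1))) fun n k => ⟨by
      have : 0 ≤ t / ((n : ℝ) + 1) := by positivity
      push_cast; nlinarith, le_rfl⟩
  refine (h1.const_sub (f t * b t - f 0 * b 0)).congr fun n => ?_
  set h : ℝ := t / (n + 1) with hh
  have h0 : 0 ≤ h := by positivity
  have hnh : ((n + 1 : ℕ) : ℝ) * h = t := by rw [hh]; push_cast; field_simp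
  have htel := Finset.sum_range_sub (fun k : ℕ => f ((k : ℝ) * h) * b ((k : ℝ) * h)) (n + 1)
  rw [hnh, Nat.cast_zero, zero_mul] at htel
  rw [← htel, ← Finset.sum_sub_distrib]
  refine Finset.sum_congr rfl fun k hk => ?_
  have hle : (k : ℝ) * h ≤ ((k + 1 : ℕ) : ℝ) * h := by push_cast; nlinarith
  have hsub : Set.Icc ((k : ℝ) * h) ((k + 1 : ℕ) * h) ⊆ Set.Icc 0 t := by
    refine Set.Icc_subset_Icc (by positivity) ?_
    rw [← hnh]
    have := Finset.mem_range.1 hk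
    gcongr
    omega
  rw [intervalIntegral.integral_eq_sub_of_hasDerivAt
    (fun s hs => hf s (hsub (by rwa [Set.uIcc_of_le hle] at hs)))
    ((hf'.mono hsub).intervalIntegrable_of_Icc hle)]
  ring

/-! ### Variation of constants -/

/-- `V - b` is a primitive of `M V` although `V` and `b` need not be differentiable, so `(F (V -
b))' = -F M (V - b) + F M V = F M b`. Summation by parts produces the same integral of `F M b`. -/
lemma tendsto_stieltjesSum_of_linear_equation {N : ℕ} {F M : ℝ → Matrix (Fin N) (Fin N) ℝ}
    {b V : ℝ → Fin N → ℝ} {w : Fin N → ℝ} {t : ℝ} (ht : 0 ≤ t)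
    (hF : ∀ s ∈ Set.Icc 0 t, ∀ i j, HasDerivAt (fun u => F u i j) (-(F s * M s) i j) s)
    (hFt : F t = 1) (hM : ∀ i j, ContinuousOn (fun s => M s i j) (Set.Icc 0 t))
    (hb : ContinuousOn b (Set.Icc 0 t)) (hV : ContinuousOn V (Set.Icc 0 t))
    (hVeq : ∀ s ∈ Set.Icc 0 t, V s = w + b s + ∫ u in (0 : ℝ)..s, M u *ᵥ V u) (i : Fin N) :
    Tendsto (fun n : ℕ => ∑ k ∈ Finset.range (n + 1), ∑ j, F ((k : ℝ) * (t / (n + 1))) i j *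
        (b ((k + 1 : ℕ) * (t / (n + 1))) j - b ((k : ℝ) * (t / (n + 1))) j))
      atTop (𝓝 (V t i - (F 0 *ᵥ w) i - (F 0 *ᵥ b 0) i)) := by
  have hFc : ∀ j, ContinuousOn (fun s => F s i j) (Set.Icc 0 t) := fun j s hs =>
    (hF s hs i j).continuousAt.continuousWithinAt
  have hbj : ∀ j, ContinuousOn (fun s => b s j) (Set.Icc 0 t) := continuousOn_pi.1 hb
  have hVj : ∀ j, ContinuousOn (fun s => V s j) (Set.Icc 0 t) := continuousOn_pi.1 hV
  have hF'c : ∀ j, ContinuousOn (fun s => -(F s * M s) i j) (Set.Icc 0 t) := fun j => by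
    simp only [Matrix.mul_apply]
    exact (continuousOn_finsetSum _ fun l _ => (hFc l).mul (hM l j)).neg
  have hMV : ContinuousOn (fun s => M s *ᵥ V s) (Set.Icc 0 t) := by
    refine continuousOn_pi.2 fun l => ?_
    simp only [Matrix.mulVec, dotProduct]
    exact continuousOn_finsetSum _ fun j _ => (hM l j).mul (hVj j)
  obtain ⟨g, hg, hMg⟩ := exists_continuous_eqOn_Icc ht hMV
  have hVg : ∀ s ∈ Set.Icc 0 t, w + ∫ u in (0 : ℝ)..s, g u = V s - b s := fun s hs => by
    rw [hVeq s hs, intervalIntegral_congr_Icc hMg hs]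
    abel
  have hd : ∀ s j, HasDerivAt (fun u => (w + ∫ u in (0 : ℝ)..u, g u) j) (g s j) s := fun s j =>
    hasDerivAt_pi.1 ((hg.integral_hasStrictDerivAt 0 s).hasDerivAt.const_add w) j
  -- the derivative of `F (V - b)` is `F M b`
  have hp : ∀ s ∈ Set.Icc 0 t, HasDerivAt
      (fun u => ∑ j, F u i j * (w + ∫ u in (0 : ℝ)..u, g u) j)
      (-∑ j, b s j * -(F s * M s) i j) s := by
    intro s hs
    have h1 := HasDerivAt.fun_sum (u := Finset.univ) fun j _ => (hF s hs i j).mul (hd s j)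
    refine h1.congr_deriv ?_
    rw [hVg s hs, ← hMg hs]
    have h2 : ∑ j, F s i j * (M s *ᵥ V s) j = ∑ j, (F s * M s) i j * V s j := by
      have := congrFun (Matrix.mulVec_mulVec (V s) (F s) (M s)) i
      simpa only [Matrix.mulVec, dotProduct] using this
    rw [Finset.sum_add_distrib, h2, ← Finset.sum_add_distrib, ← Finset.sum_neg_distrib]
    refine Finset.sum_congr rfl fun j _ => ?_
    rw [Pi.sub_apply]
    ring
  have hint : ∀ j ∈ (Finset.univ : Finset (Fin N)),
      IntervalIntegrable (fun s => b s j * -(F s * M s) i j) volume 0 t := fun j _ =>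
    ((hbj j).mul (hF'c j)).intervalIntegrable_of_Icc ht
  have hftc := intervalIntegral.integral_eq_sub_of_hasDerivAt
    (fun s hs => hp s (by rwa [Set.uIcc_of_le ht] at hs))
    (ContinuousOn.intervalIntegrable_of_Icc ht
      (continuousOn_finsetSum _ fun j _ => (hbj j).mul (hF'c j)).neg)
  rw [intervalIntegral.integral_neg, intervalIntegral.integral_finsetSum hint, hVg t ⟨ht, le_rfl⟩,
    intervalIntegral.integral_same, hFt, add_zero] at hftc
  have hlim := tendsto_finsetSum Finset.univ fun j (_ : j ∈ Finset.univ) =>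
    tendsto_stieltjesSum ht (fun s hs => hF s hs i j) (hF'c j) (hbj j)
  rw [Finset.sum_sub_distrib, Finset.sum_sub_distrib, hFt] at hlim
  refine (hlim.congr fun n => Finset.sum_comm).trans_eq ?_
  congr 1
  have e1 : ∀ v : Fin N → ℝ, ∑ j, (1 : Matrix (Fin N) (Fin N) ℝ) i j * v j = v i := fun v => by
    simpa only [Matrix.mulVec, dotProduct] using congrFun (Matrix.one_mulVec v) i
  rw [e1] at hftc ⊢
  simp only [Matrix.mulVec, dotProduct]
  rw [Pi.sub_apply] at hftc
  linarith

/-! ### The fundamental matrix and the covariance integral -/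

section MatrixExp

variable {N : ℕ} (A : Matrix (Fin N) (Fin N) ℝ)

lemma hasDerivAt_exp_smul_apply (x : ℝ) (i j : Fin N) :
    HasDerivAt (fun u : ℝ => NormedSpace.exp (u • A) i j) ((NormedSpace.exp (x • A) * A) i j) x ∧
    HasDerivAt (fun u : ℝ => NormedSpace.exp (u • A) i j)
      ((A * NormedSpace.exp (x • A)) i j) x := by
  -- Any algebra norm will do: the entrywise derivatives do not depend on it.
  let _ : NormedRing (Matrix (Fin N) (Fin N) ℝ) := Matrix.linftyOpNormedRing
  let _ : NormedAlgebra ℝ (Matrix (Fin N) (Fin N) ℝ) := Matrix.linftyOpNormedAlgebra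
  let L : Matrix (Fin N) (Fin N) ℝ →L[ℝ] ℝ :=
    LinearMap.toContinuousLinearMap (Matrix.entryLinearMap ℝ ℝ i j)
  exact ⟨L.hasFDerivAt.comp_hasDerivAt x (hasDerivAt_exp_smul_const A x),
    L.hasFDerivAt.comp_hasDerivAt x (hasDerivAt_exp_smul_const' A x)⟩

/-- The fundamental matrix of `dW/ds = (s + a)⁻¹ A W` from time `s` to time `t`. -/
noncomputable def fundamentalMatrix (a t s : ℝ) : Matrix (Fin N) (Fin N) ℝ :=
  NormedSpace.exp ((Real.log (t + a) - Real.log (s + a)) • A)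

lemma fundamentalMatrix_self (a t : ℝ) : fundamentalMatrix A a t t = 1 := by
  simp [fundamentalMatrix]

lemma hasDerivAt_fundamentalMatrix {a t s : ℝ} (hs : 0 < s + a) (i j : Fin N) :
    HasDerivAt (fun u => fundamentalMatrix A a t u i j)
      (-(fundamentalMatrix A a t s * ((s + a)⁻¹ • A)) i j) s := by
  have h1 : HasDerivAt (fun u : ℝ => Real.log (t + a) - Real.log (u + a)) (-(1 / (s + a))) s :=
    (((hasDerivAt_id s).add_const a).log hs.ne').const_sub _
  have h2 := (hasDerivAt_exp_smul_apply A (Real.log (t + a) - Real.log (s + a)) i j).1.comp s h1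
  refine h2.congr_deriv ?_
  simp only [fundamentalMatrix, Matrix.mul_smul, Matrix.smul_apply, smul_eq_mul]
  ring

variable {A}

lemma fundamentalMatrix_isSymm (hA : A.IsSymm) (a t s : ℝ) :
    (fundamentalMatrix A a t s).IsSymm := (hA.smul _).exp

lemma fundamentalMatrix_mul_transpose (hA : A.IsSymm) (a t s : ℝ) :
    fundamentalMatrix A a t s * (fundamentalMatrix A a t s)ᵀ =
      NormedSpace.exp ((2 * (Real.log (t + a) - Real.log (s + a))) • A) := by
  rw [(fundamentalMatrix_isSymm hA a t s).eq, fundamentalMatrix,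
    ← Matrix.exp_add_of_commute _ _ (Commute.refl _), ← add_smul, two_mul]

lemma exp_smul_one_add (x : ℝ) (D : Matrix (Fin N) (Fin N) ℝ) :
    NormedSpace.exp (x • (1 : Matrix (Fin N) (Fin N) ℝ) + D) = Real.exp x • NormedSpace.exp D := by
  rw [Matrix.exp_add_of_commute _ _ ((Commute.one_left D).smul_left x), Matrix.smul_one_eq_diagonal,
    Matrix.exp_diagonal, ← smul_one_mul (Real.exp x) (NormedSpace.exp D),
    Matrix.smul_one_eq_diagonal]
  congr 2
  ext i
  rw [Pi.coe_exp, Real.exp_eq_exp_ℝ]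

/-- The covariance integral in closed form. -/
lemma integral_fundamentalMatrix (hA : A.IsSymm) (hu : IsUnit (1 - (2 : ℝ) • A)) {a t : ℝ}
    (ha : 0 < a) (ht : 0 ≤ t) :
    (Matrix.of fun i j => ∫ s in (0 : ℝ)..t, ∑ l, fundamentalMatrix A a t s i l *
        fundamentalMatrix A a t s j l) =
      (t + a) • ((1 - (2 : ℝ) • A)⁻¹ *
        (1 - NormedSpace.exp (Real.log (a / (t + a)) • (1 - (2 : ℝ) • A)))) := by
  set G : ℝ → Matrix (Fin N) (Fin N) ℝ := fun s =>
    NormedSpace.exp ((2 * (Real.log (t + a) - Real.log (s + a))) • A) with hG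
  have hGd : ∀ s ∈ Set.uIcc 0 t, ∀ i j, HasDerivAt (fun u => G u i j)
      (-(2 * (s + a)⁻¹) * (A * G s) i j) s := by
    intro s hs i j
    rw [Set.uIcc_of_le ht] at hs
    have hsa : s + a ≠ 0 := by linarith [hs.1]
    have h1 : HasDerivAt (fun u : ℝ => 2 * (Real.log (t + a) - Real.log (u + a)))
        (2 * -(1 / (s + a))) s :=
      ((((hasDerivAt_id s).add_const a).log hsa).const_sub _).const_mul 2
    have h2 := (hasDerivAt_exp_smul_apply A (2 * (Real.log (t + a) - Real.log (s + a))) i j).2.comp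
      s h1
    refine h2.congr_deriv ?_
    rw [one_div]
    ring
  have hGc : ∀ i j, ContinuousOn (fun s => G s i j) (Set.uIcc 0 t) := fun i j s hs =>
    (hGd s hs i j).continuousAt.continuousWithinAt
  have hGi : ∀ i j, IntervalIntegrable (fun s => G s i j) volume 0 t := fun i j =>
    (hGc i j).intervalIntegrable
  have hQ : (Matrix.of fun i j => ∫ s in (0 : ℝ)..t, ∑ l, fundamentalMatrix A a t s i l *
      fundamentalMatrix A a t s j l) = Matrix.of fun i j => ∫ s in (0 : ℝ)..t, G s i j := by
    ext i j
    simp only [Matrix.of_apply, hG, ← fundamentalMatrix_mul_transpose hA]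
    rfl
  -- `((s + a) G)' = G - 2 A G`, so `E - 2A` times the integral is `(t + a) E - a G(0)`.
  have hPd : ∀ i j, ∀ s ∈ Set.uIcc 0 t, HasDerivAt (fun u => (u + a) * G u i j)
      (((1 - (2 : ℝ) • A) * G s) i j) s := by
    intro i j s hs
    refine (((hasDerivAt_id s).add_const a).mul (hGd s hs i j)).congr_deriv ?_
    rw [Set.uIcc_of_le ht] at hs
    have hsa : s + a ≠ 0 := by linarith [hs.1]
    simp only [Matrix.sub_mul, Matrix.one_mul, Matrix.smul_mul, Matrix.sub_apply,
      Matrix.smul_apply, smul_eq_mul, id]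
    field_simp
    ring
  have hmul : (1 - (2 : ℝ) • A) * (Matrix.of fun i j => ∫ s in (0 : ℝ)..t, G s i j) =
      (t + a) • (1 - NormedSpace.exp (Real.log (a / (t + a)) • (1 - (2 : ℝ) • A))) := by
    have hE : NormedSpace.exp (Real.log (a / (t + a)) • (1 - (2 : ℝ) • A)) =
        (a / (t + a)) • G 0 := by
      rw [smul_sub, sub_eq_add_neg, exp_smul_one_add, Real.exp_log (by positivity), hG]
      simp only
      rw [Real.log_div ha.ne' (by positivity), smul_smul, ← neg_smul]
      congr 3
      rw [zero_add]
      ring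
    ext i j
    rw [Matrix.mul_apply]
    simp only [Matrix.of_apply, ← intervalIntegral.integral_const_mul]
    rw [← intervalIntegral.integral_finsetSum fun l _ => (hGi l j).const_mul _]
    have hftc := intervalIntegral.integral_eq_sub_of_hasDerivAt (hPd i j)
      (ContinuousOn.intervalIntegrable (by
        simp only [Matrix.mul_apply]
        exact continuousOn_finsetSum _ fun l _ => continuousOn_const.mul (hGc l j)))
    simp only [Matrix.mul_apply] at hftc
    rw [hftc, hE]
    have hGt : G t = 1 := by simp [hG]
    have hta : t + a ≠ 0 := by positivity
    simp only [hGt, Matrix.smul_apply, Matrix.sub_apply, smul_eq_mul]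
    field_simp
    ring
  rw [hQ, ← Matrix.mul_smul, ← hmul, Matrix.nonsing_inv_mul_cancel_left _ _
    ((Matrix.isUnit_iff_isUnit_det _).1 hu)]

end MatrixExp

/-! ### The Gaussian space of a Brownian motion -/

/-- Linear combinations of the values of the Brownian motion. -/
def gaussianSpan {Ω : Type*} {N : ℕ} (B : ℝ≥0 → Ω → Fin N → ℝ) : Submodule ℝ (Ω → ℝ) :=
  Submodule.span ℝ (Set.range fun (p : ℝ≥0 × Fin N) ω => B p.1 ω p.2)

lemma mem_gaussianSpan {Ω : Type*} {N : ℕ} (B : ℝ≥0 → Ω → Fin N → ℝ) (t : ℝ≥0) (i : Fin N) :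
    (fun ω => B t ω i) ∈ gaussianSpan B := Submodule.subset_span ⟨(t, i), rfl⟩

section Brownian

variable {Ω : Type*} [MeasurableSpace Ω] {μ : Measure Ω} {N : ℕ} {B : ℝ≥0 → Ω → Fin N → ℝ}

lemma IsBrownianVec.isGaussianProcess (hB : IsBrownianVec B μ) :
    IsGaussianProcess (fun (p : ℝ≥0 × Fin N) ω => B p.1 ω p.2) μ where
  hasGaussianLaw I := by
    classical
    -- Independence of the coordinates gives a Gaussian vector on the full rectangle `J × Fin N`, of
    -- which the family over `I` is a linear image.
    set J : Finset ℝ≥0 := I.image Prod.fst with hJ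
    have h1 : ∀ i, HasGaussianLaw (fun ω (t : J) => B t ω i) μ := fun i =>
      (IsPreBrownianReal.isGaussianProcess (hB.brownian i).toIsPreBrownianReal).hasGaussianLaw J
    have h2 : iIndepFun (fun (i : Fin N) ω (t : J) => B t ω i) μ :=
      hB.indep.comp (fun _ x (t : J) => x t) fun _ => by fun_prop
    let L : (Fin N → J → ℝ) →L[ℝ] (I → ℝ) :=
      { toFun x p := x p.1.2 ⟨p.1.1, Finset.mem_image_of_mem _ p.2⟩
        map_add' x y := by ext; simp
        map_smul' c x := by ext; simp }
    exact (h2.hasGaussianLaw h1).map L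

lemma IsBrownianVec.memLp (hB : IsBrownianVec B μ) (t : ℝ≥0) (i : Fin N) :
    MemLp (fun ω => B t ω i) 2 μ :=
  (hB.isGaussianProcess.hasGaussianLaw_eval (t, i)).memLp_two

lemma IsBrownianVec.hasGaussianLaw_of_mem_gaussianSpan (hB : IsBrownianVec B μ) {Z : Ω → ℝ}
    (hZ : Z ∈ gaussianSpan B) : HasGaussianLaw Z μ := by
  obtain ⟨a, rfl⟩ := (Finsupp.mem_span_range_iff_exists_finsupp).1 hZ
  have := (hB.isGaussianProcess.smul (fun p => a p)).hasGaussianLaw_sum (I := a.support)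
  exact this

lemma IsBrownianVec.integral_of_mem_gaussianSpan (hB : IsBrownianVec B μ) {Z : Ω → ℝ}
    (hZ : Z ∈ gaussianSpan B) : μ[Z] = 0 := by
  induction hZ using Submodule.span_induction with
  | mem x h =>
    obtain ⟨p, rfl⟩ := h
    exact (hB.brownian p.2).integral_eval p.1
  | zero => simp
  | add x y hx hy ihx ihy =>
    have h1 := (hB.hasGaussianLaw_of_mem_gaussianSpan hx).integrable
    have h2 := (hB.hasGaussianLaw_of_mem_gaussianSpan hy).integrable
    rw [integral_add' h1 h2, ihx, ihy, add_zero]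
  | smul a x hx ih =>
    simp only [Pi.smul_apply]
    rw [integral_smul, ih, smul_zero]

lemma IsBrownianVec.covariance_eval (hB : IsBrownianVec B μ) (s t : ℝ≥0) (i j : Fin N) :
    cov[fun ω => B s ω i, fun ω => B t ω j; μ] = if i = j then ((min s t : ℝ≥0) : ℝ) else 0 := by
  split_ifs with h
  · subst h
    exact (hB.brownian i).covariance_fun_eval s t
  · have h1 : IndepFun (fun ω => B s ω i) (fun ω => B t ω j) μ :=
      (hB.indep.indepFun h).comp (φ := fun x : ℝ≥0 → ℝ => x s)
        (ψ := fun x : ℝ≥0 → ℝ => x t)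
        (by fun_prop) (by fun_prop)
    exact h1.covariance_eq_zero (hB.memLp s i) (hB.memLp t j)

lemma IsBrownianVec.covariance_increment [IsProbabilityMeasure μ] (hB : IsBrownianVec B μ)
    {τ : ℕ → ℝ≥0} (hτ : Monotone τ) (k l : ℕ) (i j : Fin N) :
    cov[fun ω => B (τ (k + 1)) ω i - B (τ k) ω i, fun ω => B (τ (l + 1)) ω j - B (τ l) ω j; μ] =
      if k = l ∧ i = j then (τ (k + 1) : ℝ) - τ k else 0 := by
  rw [covariance_fun_sub_fun_sub (hB.memLp _ _) (hB.memLp _ _) (hB.memLp _ _) (hB.memLp _ _)]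
  simp only [hB.covariance_eval]
  by_cases hij : i = j
  · simp only [hij, if_true, and_true]
    rcases lt_trichotomy k l with h | h | h
    · rw [if_neg h.ne, min_eq_left (hτ (by omega)), min_eq_left (hτ (by omega)),
        min_eq_left (hτ (by omega)), min_eq_left (hτ (by omega))]
      ring
    · subst h
      rw [if_pos rfl, min_self, min_eq_right (hτ (Nat.le_succ k)),
        min_eq_left (hτ (Nat.le_succ k)), min_self]
      ring
    · rw [if_neg h.ne', min_eq_right (hτ (by omega)), min_eq_right (hτ (by omega)),
        min_eq_right (hτ (by omega)), min_eq_right (hτ (by omega))]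
      ring
  · simp [hij]

/-- Variance of a stochastic sum with deterministic integrand. -/
lemma IsBrownianVec.variance_sum_increment [IsProbabilityMeasure μ] (hB : IsBrownianVec B μ)
    {τ : ℕ → ℝ≥0} (hτ : Monotone τ) (n : ℕ) (a : ℕ → Fin N → ℝ) :
    Var[fun ω => ∑ k ∈ Finset.range n, ∑ j, a k j * (B (τ (k + 1)) ω j - B (τ k) ω j); μ] =
      ∑ k ∈ Finset.range n, (∑ j, a k j ^ 2) * ((τ (k + 1) : ℝ) - τ k) := by
  have hm : ∀ k j, MemLp (fun ω => a k j * (B (τ (k + 1)) ω j - B (τ k) ω j)) 2 μ := fun k j =>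
    ((hB.memLp _ _).sub (hB.memLp _ _)).const_mul _
  have hm' : ∀ k, MemLp (fun ω => ∑ j, a k j * (B (τ (k + 1)) ω j - B (τ k) ω j)) 2 μ := fun k =>
    memLp_finsetSum _ fun j _ => hm k j
  rw [← covariance_self (memLp_finsetSum _ fun k _ => hm' k).aemeasurable,
    covariance_fun_sum_fun_sum' (fun k _ => hm' k) (fun k _ => hm' k)]
  refine Finset.sum_congr rfl fun k hk => ?_
  simp only [fun k l => covariance_fun_sum_fun_sum (hm k) (hm l), covariance_const_mul_left,
    covariance_const_mul_right, hB.covariance_increment hτ]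
  rw [Finset.sum_eq_single_of_mem k hk fun l _ hl => Finset.sum_eq_zero fun i _ =>
    Finset.sum_eq_zero fun j _ => by simp [hl.symm], Finset.sum_mul]
  refine Finset.sum_congr rfl fun i _ => ?_
  rw [Finset.sum_eq_single i (fun j _ hj => by simp [hj.symm]) (by simp)]
  simp
  ring

end Brownian

/-! ### Almost sure limits of linear functionals of a Brownian motion -/

section Limits

variable {Ω : Type*} [MeasurableSpace Ω] {μ : Measure Ω} [IsProbabilityMeasure μ] {N : ℕ}
  {B : ℝ≥0 → Ω → Fin N → ℝ}

lemma IsBrownianVec.exists_hasLaw_of_tendsto (hB : IsBrownianVec B μ) {S : ℕ → Ω → ℝ} {Z : Ω → ℝ}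
    {m : ℝ} (hS : ∀ n, S n ∈ gaussianSpan B) (hZ : AEMeasurable Z μ)
    (h : ∀ᵐ ω ∂μ, Tendsto (fun n => S n ω) atTop (𝓝 (Z ω - m))) :
    HasGaussianLaw Z μ ∧ Tendsto (fun n => Var[S n; μ]) atTop (𝓝 Var[Z; μ]) := by
  obtain ⟨v, hv, hlim⟩ := exists_hasLaw_gaussianReal_of_tendsto_ae
    (fun n => hB.hasGaussianLaw_of_mem_gaussianSpan (hS n))
    (fun n => hB.integral_of_mem_gaussianSpan (hS n)) (hZ.sub_const m) h
  have h1 : HasLaw Z (gaussianReal (0 + m) v) μ := by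
    simpa using gaussianReal_add_const hv m
  refine ⟨h1.hasGaussianLaw, ?_⟩
  rwa [h1.variance_eq, variance_id_gaussianReal]

/-- Cramér–Wold: a linear functional of finitely many `W t` is a limit of the same combination of
the `S n t i`, which stays in `gaussianSpan B`. -/
lemma IsBrownianVec.isGaussianProcess_of_tendsto {T : Type*} (hB : IsBrownianVec B μ)
    {W : T → Ω → Fin N → ℝ} {m : T → Fin N → ℝ} {S : ℕ → T → Fin N → Ω → ℝ}
    (hS : ∀ n t i, S n t i ∈ gaussianSpan B) (hW : ∀ t, AEMeasurable (W t) μ)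
    (h : ∀ t, ∀ᵐ ω ∂μ, ∀ i, Tendsto (fun n => S n t i ω) atTop (𝓝 (W t ω i - m t i))) :
    IsGaussianProcess W μ where
  hasGaussianLaw I := by
    classical
    refine ⟨isGaussian_of_isGaussian_map fun L => ?_⟩
    have hm : AEMeasurable (fun ω => I.restrict (W · ω)) μ :=
      aemeasurable_pi_lambda _ fun t => hW t
    rw [AEMeasurable.map_map_of_aemeasurable L.continuous.aemeasurable hm]
    set a : I → Fin N → ℝ := fun t i => L (Pi.single t (Pi.single i 1)) with ha
    have hL : ∀ x : I → Fin N → ℝ, L x = ∑ t, ∑ i, a t i * x t i := by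
      intro x
      conv_lhs => rw [← Finset.univ_sum_single x]
      rw [map_sum]
      refine Finset.sum_congr rfl fun t _ => ?_
      have h1 : x t = ∑ i, x t i • Pi.single i (1 : ℝ) := by
        conv_lhs => rw [← Finset.univ_sum_single (x t)]
        refine Finset.sum_congr rfl fun i _ => ?_
        rw [← Pi.single_smul, smul_eq_mul, mul_one]
      let Lt : (Fin N → ℝ) →ₗ[ℝ] ℝ := L.toLinearMap ∘ₗ LinearMap.single ℝ (fun _ => Fin N → ℝ) t
      change Lt (x t) = _
      conv_lhs => rw [h1, map_sum]
      refine Finset.sum_congr rfl fun i _ => ?_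
      rw [map_smul, smul_eq_mul, mul_comm]
      rfl
    refine (hB.exists_hasLaw_of_tendsto (S := fun n => ∑ t : I, ∑ i, a t i • S n t i)
      (m := ∑ t : I, ∑ i, a t i * m t i) (fun n => ?_)
      (L.continuous.measurable.comp_aemeasurable hm) ?_).1.isGaussian_map
    · exact Submodule.sum_mem _ fun t _ => Submodule.sum_mem _ fun i _ =>
        Submodule.smul_mem _ _ (hS n t i)
    · filter_upwards [ae_all_iff.2 fun t : I => h t] with ω hω
      have e : (L ∘ fun ω => I.restrict (W · ω)) ω - ∑ t : I, ∑ i, a t i * m t i =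
          ∑ t : I, ∑ i, a t i * (W t ω i - m t i) := by
        rw [Function.comp_apply, hL, ← Finset.sum_sub_distrib]
        refine Finset.sum_congr rfl fun t _ => ?_
        rw [← Finset.sum_sub_distrib]
        refine Finset.sum_congr rfl fun i _ => ?_
        rw [mul_sub]
        rfl
      rw [e]
      simp only [Finset.sum_apply, Pi.smul_apply, smul_eq_mul]
      exact tendsto_finsetSum _ fun t _ => tendsto_finsetSum _ fun i _ => (hω t i).const_mul _

end Limits

/-- Polarization; it reduces covariances to variances of linear combinations. -/
lemma isSymm_ext_of_dotProduct {N : ℕ} {C Q : Matrix (Fin N) (Fin N) ℝ} (hC : C.IsSymm)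
    (hQ : Q.IsSymm) (h : ∀ θ : Fin N → ℝ, ∑ i, ∑ j, θ i * θ j * C i j = ∑ i, ∑ j, θ i * θ j * Q i j) :
    C = Q := by
  have hform : ∀ (R : Matrix (Fin N) (Fin N) ℝ) (θ : Fin N → ℝ),
      ∑ i, ∑ j, θ i * θ j * R i j = θ ⬝ᵥ (R *ᵥ θ) := by
    intro R θ
    simp only [dotProduct, Matrix.mulVec, Finset.mul_sum]
    exact Finset.sum_congr rfl fun i _ => Finset.sum_congr rfl fun j _ => by ring
  simp only [hform] at h
  have hexp : ∀ (R : Matrix (Fin N) (Fin N) ℝ), R.IsSymm → ∀ i j,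
      (Pi.single i 1 + Pi.single j 1) ⬝ᵥ (R *ᵥ (Pi.single i 1 + Pi.single j 1)) =
        Pi.single i 1 ⬝ᵥ (R *ᵥ Pi.single i 1) + Pi.single j 1 ⬝ᵥ (R *ᵥ Pi.single j 1) +
          2 * R i j := by
    intro R hR i j
    have := hR.apply i j
    simp only [Matrix.mulVec_add, dotProduct_add, add_dotProduct, Matrix.mulVec_single_one,
      single_one_dotProduct, Matrix.col_apply]
    linarith
  ext i j
  have h1 := h (Pi.single i 1 + Pi.single j 1)
  rw [hexp C hC, hexp Q hQ, h, h] at h1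
  linarith

/-! ### The linear equation along the explicit flow -/

/-- The equidistant partition of `[0, t]` into `n + 1` intervals. -/
noncomputable def gridPoint (n : ℕ) (t : ℝ≥0) (k : ℕ) : ℝ≥0 := k * (t / (n + 1))

lemma gridPoint_monotone (n : ℕ) (t : ℝ≥0) : Monotone (gridPoint n t) := fun k l h => by
  unfold gridPoint
  gcongr

lemma coe_gridPoint (n : ℕ) (t : ℝ≥0) (k : ℕ) :
    (gridPoint n t k : ℝ) = (k : ℝ) * ((t : ℝ) / (n + 1)) := by
  simp [gridPoint]

/-- The stochastic sums that approximate the solution of the linear equation. -/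
noncomputable def stochasticSum {Ω : Type*} {N : ℕ} (B : ℝ≥0 → Ω → Fin N → ℝ)
    (A : Matrix (Fin N) (Fin N) ℝ) (a : ℝ) (n : ℕ) (t : ℝ≥0) (i : Fin N) (ω : Ω) : ℝ :=
  ∑ k ∈ Finset.range (n + 1), ∑ j, fundamentalMatrix A a t (gridPoint n t k) i j *
    (B (gridPoint n t (k + 1)) ω j - B (gridPoint n t k) ω j)

lemma stochasticSum_mem {Ω : Type*} {N : ℕ} (B : ℝ≥0 → Ω → Fin N → ℝ)
    (A : Matrix (Fin N) (Fin N) ℝ) (a : ℝ) (n : ℕ) (t : ℝ≥0) (i : Fin N) :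
    stochasticSum B A a n t i ∈ gaussianSpan B := by
  have : stochasticSum B A a n t i = ∑ k ∈ Finset.range (n + 1), ∑ j,
      fundamentalMatrix A a t (gridPoint n t k) i j •
        ((fun ω => B (gridPoint n t (k + 1)) ω j) - fun ω => B (gridPoint n t k) ω j) := by
    ext ω
    simp [stochasticSum]
  rw [this]
  exact Submodule.sum_mem _ fun k _ => Submodule.sum_mem _ fun j _ => Submodule.smul_mem _ _
    (Submodule.sub_mem _ (mem_gaussianSpan B _ j) (mem_gaussianSpan B _ j))

section LinearSDE

variable {Ω : Type*} [MeasurableSpace Ω] {μ : Measure Ω} {N : ℕ} {B : ℝ≥0 → Ω → Fin N → ℝ}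
  {φ : ℝ → Fin N → ℝ} {w : Fin N → ℝ} {W : ℝ≥0 → Ω → Fin N → ℝ}
  {A : Matrix (Fin N) (Fin N) ℝ} {a : ℝ}

lemma IsLinearSDE.tendsto_stochasticSum (hB : IsBrownianVec B μ) (hW : IsLinearSDE B μ φ w W)
    (ha : 0 < a) (hA : ∀ s, 0 ≤ s → matrixA (φ s) = (s + a)⁻¹ • A) :
    ∀ᵐ ω ∂μ, ∀ t i, Tendsto (fun n => stochasticSum B A a n t i ω) atTop
      (𝓝 (W t ω i - (fundamentalMatrix A a t 0 *ᵥ w) i)) := by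
  filter_upwards [hW.cont, hW.eq, ae_all_iff.2 fun j => (hB.brownian j).cont,
    ae_all_iff.2 fun j => (hB.brownian j).eval_zero_ae_eq_zero] with ω h1 h2 h3 h4 t i
  have hBc : Continuous fun t => B t ω := continuous_pi h3
  have key := tendsto_stieltjesSum_of_linear_equation (F := fundamentalMatrix A a t)
    (M := fun s => (s + a)⁻¹ • A) (b := fun s => B s.toNNReal ω) (V := fun s => W s.toNNReal ω)
    (w := w) t.coe_nonneg (fun s hs i j => hasDerivAt_fundamentalMatrix A (by linarith [hs.1]) i j)
    (fundamentalMatrix_self A a t) (fun i j => by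
      simp only [Matrix.smul_apply, smul_eq_mul]
      exact ((continuousOn_id.add continuousOn_const).inv₀ fun s hs =>
        (by have := hs.1; simp only [id]; linarith : (0 : ℝ) < id s + a).ne').mul continuousOn_const)
    (hBc.comp continuous_real_toNNReal).continuousOn
    (h1.comp continuous_real_toNNReal).continuousOn
    (fun s hs => by
      have h5 := h2 s.toNNReal
      rw [Real.coe_toNNReal _ hs.1] at h5
      rw [h5]
      congr 1
      refine intervalIntegral.integral_congr fun u hu => ?_
      rw [Set.uIcc_of_le hs.1] at hu
      exact congrArg (· *ᵥ W u.toNNReal ω) (hA u hu.1)) i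
  -- Brownian motion starts at zero, which removes the boundary term `F(0) b(0)`.
  have h0 : B (Real.toNNReal 0) ω = 0 := by
    ext j
    simpa using h4 j
  rw [h0, Matrix.mulVec_zero, Pi.zero_apply, sub_zero] at key
  have hto : ((t : ℝ)).toNNReal = t := Real.toNNReal_coe
  rw [hto] at key
  refine key.congr fun n => ?_
  simp only [stochasticSum, ← coe_gridPoint, Real.toNNReal_coe]

variable [IsProbabilityMeasure μ]

lemma IsLinearSDE.isGaussianProcess (hB : IsBrownianVec B μ) (hW : IsLinearSDE B μ φ w W)
    (ha : 0 < a) (hA : ∀ s, 0 ≤ s → matrixA (φ s) = (s + a)⁻¹ • A) : IsGaussianProcess W μ :=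
  hB.isGaussianProcess_of_tendsto (S := stochasticSum B A a) (stochasticSum_mem B A a)
    hW.aemeasurable fun t => (hW.tendsto_stochasticSum hB ha hA).mono fun _ h => h t

/-- Itô isometry in the limit: the variances of the approximating sums converge to the variance of
the limit, and they are also Riemann sums of the integral. -/
lemma IsLinearSDE.variance_eq (hB : IsBrownianVec B μ) (hW : IsLinearSDE B μ φ w W)
    (ha : 0 < a) (hA : ∀ s, 0 ≤ s → matrixA (φ s) = (s + a)⁻¹ • A) (t : ℝ≥0) (θ : Fin N → ℝ) :
    Var[fun ω => ∑ i, θ i * W t ω i; μ] =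
      ∫ s in (0 : ℝ)..t, ∑ l, (∑ i, θ i * fundamentalMatrix A a t s i l) ^ 2 := by
  have hlim := (hB.exists_hasLaw_of_tendsto (S := fun n => ∑ i, θ i • stochasticSum B A a n t i)
    (Z := fun ω => ∑ i, θ i * W t ω i) (m := ∑ i, θ i * (fundamentalMatrix A a t 0 *ᵥ w) i)
    (fun n => Submodule.sum_mem _ fun i _ => Submodule.smul_mem _ _ (stochasticSum_mem B A a n t i))
    (Finset.aemeasurable_fun_sum _ fun i _ =>
      ((measurable_pi_apply i).comp_aemeasurable (hW.aemeasurable t)).const_mul _) (by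
      filter_upwards [hW.tendsto_stochasticSum hB ha hA] with ω hω
      rw [← Finset.sum_sub_distrib]
      simp only [← mul_sub, Finset.sum_apply, Pi.smul_apply, smul_eq_mul]
      exact tendsto_finsetSum _ fun i _ => (hω t i).const_mul _)).2
  refine tendsto_nhds_unique hlim ?_
  have hc : ∀ i l, ContinuousOn (fun s => fundamentalMatrix A a t s i l) (Set.Icc 0 (t : ℝ)) :=
    fun i l s hs => (hasDerivAt_fundamentalMatrix A (by linarith [hs.1]) i
      l).continuousAt.continuousWithinAt
  refine (tendsto_riemannSum
    (u := fun s => ∑ l, (∑ i, θ i * fundamentalMatrix A a t s i l) ^ 2) t.coe_nonneg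
    (continuousOn_finsetSum _ fun l _ =>
    (continuousOn_finsetSum _ fun i _ => continuousOn_const.mul (hc i l)).pow 2)).congr fun n => ?_
  have e : (∑ i, θ i • stochasticSum B A a n t i) = fun ω => ∑ k ∈ Finset.range (n + 1), ∑ j,
      (∑ i, θ i * fundamentalMatrix A a t (gridPoint n t k) i j) *
        (B (gridPoint n t (k + 1)) ω j - B (gridPoint n t k) ω j) := by
    ext ω
    simp only [Finset.sum_apply, Pi.smul_apply, smul_eq_mul, stochasticSum, Finset.mul_sum,
      Finset.sum_mul]
    rw [Finset.sum_comm]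
    refine Finset.sum_congr rfl fun k _ => ?_
    rw [Finset.sum_comm]
    exact Finset.sum_congr rfl fun j _ => Finset.sum_congr rfl fun i _ => by ring
  rw [e, hB.variance_sum_increment (gridPoint_monotone n t) (n + 1)
    fun k j => ∑ i, θ i * fundamentalMatrix A a t (gridPoint n t k) i j]
  refine Finset.sum_congr rfl fun k _ => ?_
  rw [coe_gridPoint, coe_gridPoint]
  push_cast
  ring_nf

lemma IsLinearSDE.covariance_eq (hB : IsBrownianVec B μ) (hW : IsLinearSDE B μ φ w W)
    (ha : 0 < a) (hA : ∀ s, 0 ≤ s → matrixA (φ s) = (s + a)⁻¹ • A) (t : ℝ≥0) :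
    (Matrix.of fun i j => cov[fun ω => W t ω i, fun ω => W t ω j; μ]) =
      Matrix.of fun i j => ∫ s in (0 : ℝ)..t, ∑ l, fundamentalMatrix A a t s i l *
        fundamentalMatrix A a t s j l := by
  refine isSymm_ext_of_dotProduct ?_ ?_ fun θ => ?_
  · ext i j
    exact covariance_comm _ _
  · ext i j
    simp only [Matrix.transpose_apply, Matrix.of_apply, mul_comm]
  have hm : ∀ i, MemLp (fun ω => W t ω i) 2 μ := fun i =>
    (((hW.isGaussianProcess hB ha hA).hasGaussianLaw_eval t).map (.proj i)).memLp_two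
  have hm' : ∀ i, MemLp (fun ω => θ i * W t ω i) 2 μ := fun i => (hm i).const_mul _
  have hvar := hW.variance_eq hB ha hA t θ
  rw [← covariance_self (memLp_finsetSum _ fun i _ => hm' i).aemeasurable,
    covariance_fun_sum_fun_sum hm' hm'] at hvar
  simp only [covariance_const_mul_left, covariance_const_mul_right] at hvar
  simp only [Matrix.of_apply]
  have hc : ∀ i l, ContinuousOn (fun s => fundamentalMatrix A a t s i l) (Set.uIcc 0 (t : ℝ)) := by
    intro i l s hs
    rw [Set.uIcc_of_le t.coe_nonneg] at hs
    exact (hasDerivAt_fundamentalMatrix A (by linarith [hs.1]) i l).continuousAt.continuousWithinAt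
  have hi : ∀ i j, IntervalIntegrable (fun s => θ i * θ j * ∑ l, fundamentalMatrix A a t s i l *
      fundamentalMatrix A a t s j l) volume 0 t := fun i j =>
    (continuousOn_const.mul (continuousOn_finsetSum _ fun l _ =>
      (hc i l).mul (hc j l))).intervalIntegrable
  simp only [← intervalIntegral.integral_const_mul]
  rw [Finset.sum_congr rfl fun i _ =>
      (intervalIntegral.integral_finsetSum fun j _ => hi i j).symm,
    ← intervalIntegral.integral_finsetSum fun i _ => by
      have := IntervalIntegrable.sum Finset.univ fun j (_ : j ∈ Finset.univ) => hi i j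
      simpa only [Finset.sum_fn] using this]
  calc _ = ∑ i, ∑ j, θ j * (θ i * cov[fun ω => W t ω i, fun ω => W t ω j; μ]) :=
        Finset.sum_congr rfl fun i _ => Finset.sum_congr rfl fun j _ => by ring
    _ = _ := hvar
    _ = _ := by
        refine intervalIntegral.integral_congr fun s _ => ?_
        simp only [sq, Finset.sum_mul_sum]
        simp only [Finset.mul_sum]
        rw [Finset.sum_comm]
        refine Finset.sum_congr rfl fun i _ => ?_
        rw [Finset.sum_comm]
        exact Finset.sum_congr rfl fun j _ => Finset.sum_congr rfl fun l _ => by ring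

end LinearSDE

lemma matrixA_flow {N : ℕ} (hN : 1 ≤ N) {r : Fin N → ℝ} (hr : IsLaguerreVector r) {c : ℝ}
    (hc : 0 < c) {φ : ℝ → Fin N → ℝ} (hφ : IsFlow φ (c • r)) {s : ℝ} (hs : 0 ≤ s) :
    matrixA (φ s) = (s + c ^ 2)⁻¹ • matrixA r := by
  rw [flow_eq hN hr hc hφ hs, matrixA_smul, Real.sq_sqrt (by positivity)]

end BesselD

theorem lemma4p4 {Ω : Type*} [MeasurableSpace Ω] (μ : Measure Ω) [IsProbabilityMeasure μ]
    {N : ℕ} (hN : 1 ≤ N) (r : Fin N → ℝ) (hr : BesselD.IsLaguerreVector r)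
    (c : ℝ) (hc : 0 < c) (φ : ℝ → Fin N → ℝ) (hφ : BesselD.IsFlow φ (c • r))
    (B : ℝ≥0 → Ω → Fin N → ℝ) (hB : BesselD.IsBrownianVec B μ)
    (w : Fin N → ℝ) (W : ℝ≥0 → Ω → Fin N → ℝ) (hW : BesselD.IsLinearSDE B μ φ w W) :
    -- `W` is the freezing limit of the Bessel processes started in `√k c r + w`
    (∀ (k₀ : ℝ) (X : ℝ → ℝ≥0 → Ω → Fin N → ℝ), 1 / 2 ≤ k₀ →
      (∀ k, k₀ ≤ k → √k • c • r + w ∈ interior (BesselD.chamber N)) →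
      (∀ k, k₀ ≤ k → BesselD.IsBesselD B μ k (√k • c • r + w) (X k)) →
      BesselD.IsFreezingLimit μ k₀ X φ W) ∧
    -- it is Gaussian
    IsGaussianProcess W μ ∧
    -- and has the following covariance matrices
    IsUnit (1 - (2 : ℝ) • BesselD.matrixA r) ∧
    ∀ t : ℝ≥0, 0 < t →
      (Matrix.of fun i j => cov[fun ω => W t ω i, fun ω => W t ω j; μ]) =
        ((t : ℝ) + c ^ 2) • ((1 - (2 : ℝ) • BesselD.matrixA r)⁻¹ *
          (1 - NormedSpace.exp
            (Real.log (c ^ 2 / ((t : ℝ) + c ^ 2)) • (1 - (2 : ℝ) • BesselD.matrixA r)))) := by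

  have hA := fun s hs => BesselD.matrixA_flow hN hr hc hφ (s := s) hs
  have hc2 : 0 < c ^ 2 := by positivity
  have hu := BesselD.isUnit_one_sub_two_smul_matrixA r
  refine ⟨fun k₀ X hk₀ _ hX => BesselD.isFreezingLimit hN hr hc hφ hW (by linarith) hX,
    hW.isGaussianProcess hB hc2 hA, hu, fun t _ => ?_⟩
  rw [hW.covariance_eq hB hc2 hA t,
    BesselD.integral_fundamentalMatrix (BesselD.matrixA_isSymm r) hu hc2 t.coe_nonneg]
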